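/- **Notation.** Let $[k]=q^{k/2}-q^{-k/2}$, $t_k=[k]^2$, $t=t_1$. For $u_1,u_2$ in the ring $\mathcal L[t]$ of quotients $f_2(t)/f_1(t)$ with $f_1,f_2\in\mathbb Z[t]$, $f_1$ monic, write $u_1\sim_{\mathbb Z}u_2$ if $u_1-u_2\in\mathbb Z[t]$; for $u_1,u_2\in\mathbb Q(t)$ write $u_1\sim_{\mathbb Q}u_2$ if $u_1-u_2\in\mathbb Q[t]$. For a partition $\mu$ (parts $\mu_1\ge\mu_2\ge\dots\geq 1$) let $l(\mu)$ be its number of parts and $|\mu|$ their sum. **VEV forests.** For integers $(c_1,n_1),\dots,(c_l,n_l)$ draw a row of $l$ black vertices with leaf indices $1,\dots,l$ and these labels, and repeat the following. If the rightmost vertex of the row has $c=0$, remove it from the row; it is the root of a component. If the rightmost vertex has $c>0$, or the leftmost has $c<0$, discard the drawing. Otherwise take the rightmost adjacent pair with labels $(a,m),(b,n)$, $a\ge 0>b$, and continue in two ways: (i) exchange the two vertices; (ii) join them to a new vertex $v$ below, with $L(v),R(v)$ the left and right vertex of the pair and label $(c_v,n_v)=(a+b,m+n)$; if this label is not $(0,0)$,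 $v$ is black and replaces the pair in the row, and if it is $(0,0)$, $v$ is white, the pair is removed from the row and $v$ is the root of a component. Stop when the row is empty. The graphs so obtained are forests of binary trees (*VEV trees*) and form a set ${\rm Graph}^\bullet(\vec c,\vec n)$. For $a\in\mathbb Z$ and partitions $\mu,\nu$ with $|\mu|=|\nu|$, ${\rm Graph}^\bullet_a(\mu,\nu)$ is this set for $\vec c=(\mu_{l(\mu)},\dots,\mu_1,-\nu_1,\dots,-\nu_{l(\nu)})$, $\vec n=(0,\dots,0,a\nu_1,\dots,a\nu_{l(\nu)})$. For a VEV tree $T$ let $\zeta_v=c_{L(v)}n_{R(v)}-n_{L(v)}c_{R(v)}$ for each non-leaf vertex $v$, let $m(T)$ be the gcd of the $|c_v|$ over the leaves $v$ of $T$, and $$\mathcal A(T)=\begin{cases}\prod_{v}[\zeta_v]\,/\,[n_{\rm root}]&(n_{\rm root}\ne0)\\ c_{L({\rm root})}\prod_{v\neq{\rm root}}[\zeta_v]&(n_{\rm root}=0)\end{cases},\qquad \mathcal B(T)=\frac{\mathcal A(T)}{\prod_{v\ \rm leaf}[\,|c_v|\,]}.$$ **Combined forests.** Fix $r\ge2$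 and $\gamma\in\mathbb Z^r$; indices $i$ are cyclic modulo $r$. An *$r$-set* is a triple $(\vec\mu,\vec\nu,\vec\lambda)$ of $r$-tuples of partitions with $|\mu^i|+|\lambda^i|=|\nu^i|+|\lambda^{i+1}|$ for all $i$; let $d_i=|\mu^i|+|\lambda^i|$, $l(\vec\mu)=\sum_i l(\mu^i)$ (likewise for $\vec\nu,\vec\lambda$), and let $\gcd(\vec\mu,\vec\nu,\vec\lambda)$ be the gcd of all parts. A *combined forest* $W\in{\rm Comb}^\bullet_\gamma(\vec\mu,\vec\nu,\vec\lambda)$ is built from forests $F_i\in{\rm Graph}^\bullet_{\gamma_i+2}(\mu^i\cup\lambda^i,\nu^i\cup\lambda^{i+1})$, $1\le i\le r$, by joining, for every part $\lambda^i_j$, the left leaf of $F_i$ and the right leaf of $F_{i-1}$ belonging to $\lambda^i_j$ by an edge $b$, a *bridge*, with label $h(b)=\lambda^i_j$. (Among leaves with equal labels the outer ones belong to $\lambda$ and the inner ones to $\mu$ or $\nu$; among equal parts of $\lambda^i$ the one with larger $j$ is further out.) ${\rm Comb}^\circ_\gamma$ is the subset of connected $W$, and $\beta(W)=\#\text{edges}-\#\text{vertices}+1$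 is the cycle rank. $W_{(k)}$ denotes $W$ with all vertex labels and bridge labels multiplied by $k$; it belongs to the $r$-set $(k\vec\mu,k\vec\nu,k\vec\lambda)$. With $L_1(W)=l(\vec\mu)+l(\vec\nu)$ and $L_2(W)=\sum_i\gamma_id_i$, put $$\mathcal H(W)=(-1)^{L_1(W)+L_2(W)}\prod_{T\text{ VEV tree in }W}\mathcal B(T)\prod_{b\text{ bridge}}[h(b)]^2,$$ $$\mathcal G_k(W)=\sum_{k'\mid k}\mu\!\left(\tfrac k{k'}\right)k'^{-l(\vec\mu)-l(\vec\nu)-l(\vec\lambda)+1}\,\mathcal H(W_{(k')})\big|_{q\to q^{k/k'}},$$ where $\mu(\cdot)$ is the Möbius function. Let $VT_I(W)$ be the set of VEV trees $T$ in $W$ such that $m(T)$ and $n_{\rm root}$ are both odd. **Proposition.** Let $(\vec\mu,\vec\nu,\vec\lambda)$ be an $r$-set with $\gcd(\vec\mu,\vec\nu,\vec\lambda)=1$, and let $W\in{\rm Comb}^\circ_\gamma(\vec\mu,\vec\nu,\vec\lambda)$ be a connected combined forest with $\beta(W)=0$. 1. If $k$ is an odd positive integer, then (both sides lie in $\mathcal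 L[t]$ and) $$\mathcal H(W_{(k)})\sim_{\mathbb Z}k^{l(\vec\mu)+l(\vec\nu)+l(\vec\lambda)-1}\,\mathcal H(W)|_{t\to t_k}.$$ 2. If $k$ is an even positive integer, then (both sides lie in $\mathcal L[t]$ and) $$\mathcal H(W_{(k)})\sim_{\mathbb Z}(-1)^{L_2(W)}k^{l(\vec\mu)+l(\vec\nu)+l(\vec\lambda)-1}\,\mathcal H(W)|_{t\to t_k}\prod_{T\in VT_I(W)}\Big(1+\frac{t_{m(T)k/2}}2\Big).$$ 3. $\mathcal G_k(W)\in\mathbb Q(t)$, with $\mathcal G_k(W)\sim_{\mathbb Q}0$ for $k>2$ and $\mathcal G_k(W)\sim_{\mathbb Q}a/t$ for $k=1,2$, with a constant $a\in\mathbb Q$ (depending on $W$ and $k$). -/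

import Mathlib

noncomputable section

namespace TopString

/-! ### The field `ℚ(q^{1/2})`, `q`-numbers and the relations modulo `ℤ[t]` and `ℚ[t]` -/

/-- The field of rational functions over `ℚ` in one variable; the variable is `q^{1/2}`. -/
abbrev K : Type := RatFunc ℚ

/-- The `q`-number `[k] = q^{k/2} - q^{-k/2}` of an integer `k`. -/
def qnum (k : ℤ) : K := (RatFunc.X : K) ^ k - (RatFunc.X : K) ^ (-k)

/-- `t_k = [k]^2`. -/
def tk (k : ℕ) : K := qnum (k : ℤ) ^ 2

/-- `t = [1]^2`. -/
def t : K := tk 1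

/-- The substitution `q → q^k` (for `k ≥ 1`), that is `q^{1/2} → q^{k/2}`. It sends `t` to `t_k`,
so on rational functions of `t` it is the substitution `t → t_k`. -/
def subst (k : ℕ) (u : K) : K :=
  RatFunc.eval (algebraMap ℚ K) ((RatFunc.X : K) ^ k) u

/-- Membership in the ring `𝓛[t]` of quotients `f₂(t) / f₁(t)` with `f₁, f₂` integer polynomials
and `f₁` monic. -/
def MemL (u : K) : Prop :=
  ∃ f₁ f₂ : Polynomial ℤ, f₁.Monic ∧ u = Polynomial.aeval t f₂ / Polynomial.aeval t f₁

/-- Membership in the field `ℚ(t)`. -/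
def MemQt (u : K) : Prop :=
  ∃ f₁ f₂ : Polynomial ℚ, f₁ ≠ 0 ∧ u = Polynomial.aeval t f₂ / Polynomial.aeval t f₁

/-- The relation `u ∼_ℤ v` in the ring `𝓛[t]`: the difference is in `ℤ[t]`. -/
def SimZ (u v : K) : Prop :=
  MemL u ∧ MemL v ∧ ∃ P : Polynomial ℤ, u - v = Polynomial.aeval t P

/-- The relation `u ∼_ℚ v` in the field `ℚ(t)`: the difference is in `ℚ[t]`. -/
def SimQ (u v : K) : Prop :=
  MemQt u ∧ MemQt v ∧ ∃ P : Polynomial ℚ, u - v = Polynomial.aeval t P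

/-! ### VEV trees and VEV forests -/

/-- Binary trees drawn with the leaves on top and the root at the bottom. A leaf carries its leaf
index and its vertex label `(c, n)`; `node l r` is the tree whose root `v` has upper left
neighbour `L(v)`, the root of `l`, and upper right neighbour `R(v)`, the root of `r`.
A vertex of a tree is represented by the subtree above it (of which it is the root); the leaves of
the graphs below have pairwise different leaf indices, so different vertices are different
subtrees. -/
inductive VTree : Type
  | leaf (idx : ℕ) (c n : ℤ) : VTree
  | node (l r : VTree) : VTree

namespace VTree

/-- First component `c_v` of the vertex label of the root. -/
def c : VTree → ℤ
  | leaf _ c _ => c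
  | node l r => l.c + r.c

/-- Second component `n_v` of the vertex label of the root. -/
def n : VTree → ℤ
  | leaf _ _ n => n
  | node l r => l.n + r.n

/-- The tree with all vertex labels multiplied by `k`. -/
def scale (k : ℕ) : VTree → VTree
  | leaf i c n => leaf i (k * c) (k * n)
  | node l r => node (l.scale k) (r.scale k)

/-- The vertices of a tree, as subtrees. -/
def subtrees : VTree → List VTree
  | leaf i c n => [leaf i c n]
  | node l r => node l r :: (l.subtrees ++ r.subtrees)

/-- `u.IsUpper v`: the vertex `u` is one of the two upper neighbours `L(v)`, `R(v)` of `v`. -/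
def IsUpper (u v : VTree) : Prop :=
  ∃ w, v = node u w ∨ v = node w u

/-- `ζ_v` for the vertex `v` with upper neighbours the roots of `l` and `r`: the determinant of
their vertex labels. -/
def zeta (l r : VTree) : ℤ := l.c * r.n - l.n * r.c

/-- The product of `[ζ_v]` over all vertices `v` with two upper neighbours. -/
def zetaProd : VTree → K
  | leaf _ _ _ => 1
  | node l r => qnum (zeta l r) * (l.zetaProd * r.zetaProd)

/-- The amplitude `𝓐(T)`. If `n_root ≠ 0` it is `∏_v [ζ_v] / [n_root]`; if `n_root = 0` it is
`c_{L(root)}` times the product of the `[ζ_v]` with `v` not the root. -/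
def ampA : VTree → K
  | leaf i c n => (leaf i c n).zetaProd / qnum n
  | node l r =>
      if (node l r).n = 0 then (l.c : K) * (l.zetaProd * r.zetaProd)
      else (node l r).zetaProd / qnum (node l r).n

/-- `[μ][ν]`, where `μ` is the partition of the labels `c_v` of the left leaves and `ν` that of the
labels `-c_v` of the right leaves. -/
def leafProd : VTree → K
  | leaf _ c _ => qnum (c.natAbs : ℤ)
  | node l r => l.leafProd * r.leafProd

/-- `m(T) = gcd(μ, ν)`, the greatest common divisor of all `|c_v|`, `v` a leaf. -/
def m : VTree → ℕ
  | leaf _ c _ => c.natAbs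
  | node l r => Nat.gcd l.m r.m

/-- `𝓑(T) = 𝓐(T) / ([μ][ν])`. -/
def ampB (T : VTree) : K := T.ampA / T.leafProd

end VTree

/-- `Generates X F`: from the row `X` of black vertices (each with the tree above it) the graph
generating algorithm for the vacuum expectation value produces a forest with connected components
`F`, listed in a fixed order.
* `nil`: nothing is left.
* `strip`: the rightmost vertex has `c = 0`; it is left untouched and its tree is a component.
* In the other three rules the rightmost vertex has `c < 0` and `T`, `S` is the rightmost adjacent
  pair with `c_T ≥ 0` and `c_S < 0`. The commutation relation gives two terms: either the two
  vertices are exchanged (`swap`) or they are joined in a new vertex, which is black and stays in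
  the row if its label is not `(0, 0)` (`merge`), and is white, hence the root of a component,
  otherwise (`white`).
A row whose rightmost vertex has `c > 0` or whose leftmost vertex has `c < 0` is erased: no rule
leads from such a row to a forest. -/
inductive Generates : List VTree → List VTree → Prop
  | nil : Generates [] []
  | strip (L : List VTree) (T : VTree) (F : List VTree) (hT : T.c = 0)
      (h : Generates L F) : Generates (L ++ [T]) (T :: F)
  | swap (L : List VTree) (T S : VTree) (R F : List VTree) (hT : 0 ≤ T.c) (hS : S.c < 0)
      (hR : ∀ U ∈ R, U.c < 0)
      (h : Generates (L ++ S :: T :: R) F) : Generates (L ++ T :: S :: R) F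
  | merge (L : List VTree) (T S : VTree) (R F : List VTree) (hT : 0 ≤ T.c) (hS : S.c < 0)
      (hR : ∀ U ∈ R, U.c < 0) (hne : ¬(T.c + S.c = 0 ∧ T.n + S.n = 0))
      (h : Generates (L ++ VTree.node T S :: R) F) : Generates (L ++ T :: S :: R) F
  | white (L : List VTree) (T S : VTree) (R F : List VTree) (hT : 0 ≤ T.c) (hS : S.c < 0)
      (hR : ∀ U ∈ R, U.c < 0) (heq : T.c + S.c = 0 ∧ T.n + S.n = 0)
      (h : Generates (L ++ R) F) : Generates (L ++ T :: S :: R) (VTree.node T S :: F)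

/-- `Graph^•(c, n)` for the sequence of labels `(c_1, n_1), …, (c_l, n_l)`: the VEV forests, given
by their connected components. Leaf indices are counted from `0`, from the left. -/
def graphs (cn : List (ℤ × ℤ)) : Set (List VTree) :=
  {F | Generates (cn.mapIdx fun i p => VTree.leaf i p.1 p.2) F}

/-! ### Partitions and `r`-sets -/

/-- A partition, given by the non-increasing list of its parts. -/
def IsPartition (p : List ℕ) : Prop := p.Pairwise (· ≥ ·) ∧ ∀ x ∈ p, 0 < x

/-- The partition `μ ∪ ν`. -/
def ptnUnion (p p' : List ℕ) : List ℕ := (p ++ p').insertionSort (· ≥ ·)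

/-- `Graph_a^•(μ, ν)`: `c = (μ_l, …, μ_1, -ν_1, …, -ν_l')` and
`n = (0, …, 0, aν_1, …, aν_l')`. -/
def graphsOfPartitions (a : ℤ) (mu nu : List ℕ) : Set (List VTree) :=
  graphs (mu.reverse.map (fun x => ((x : ℤ), (0 : ℤ))) ++ nu.map (fun x => (-(x : ℤ), a * x)))

/-- Triples of `r`-tuples of lists of natural numbers. The superscripts `1, …, r` of the tuples
are the elements of `Fin r`, with cyclic arithmetic. -/
structure Triple (r : ℕ) where
  mu : Fin r → List ℕ
  nu : Fin r → List ℕ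
  lam : Fin r → List ℕ

namespace Triple

variable {r : ℕ}

/-- `r`-sets: triples of `r`-tuples of partitions with `|μ^i| + |λ^i| = |ν^i| + |λ^{i+1}|`. -/
def IsRSet [NeZero r] (S : Triple r) : Prop :=
  (∀ i, IsPartition (S.mu i) ∧ IsPartition (S.nu i) ∧ IsPartition (S.lam i)) ∧
    ∀ i, (S.mu i).sum + (S.lam i).sum = (S.nu i).sum + (S.lam (i + 1)).sum

/-- The greatest common divisor of all parts (`0` if there are no parts). -/
def gcd (S : Triple r) : ℕ :=
  Finset.univ.gcd fun i => (S.mu i ++ S.nu i ++ S.lam i).foldr Nat.gcd 0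

/-- `(kμ, kν, kλ)`. -/
def scale (k : ℕ) (S : Triple r) : Triple r where
  mu i := (S.mu i).map (k * ·)
  nu i := (S.nu i).map (k * ·)
  lam i := (S.lam i).map (k * ·)

/-- `l(μ)`. -/
def lenMu (S : Triple r) : ℕ := ∑ i, (S.mu i).length

/-- `l(ν)`. -/
def lenNu (S : Triple r) : ℕ := ∑ i, (S.nu i).length

/-- `l(λ)`. -/
def lenLam (S : Triple r) : ℕ := ∑ i, (S.lam i).length

/-- The degree `(|μ^i| + |λ^i|)_i`. -/
def degree (S : Triple r) (i : Fin r) : ℕ := (S.mu i).sum + (S.lam i).sum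

end Triple

/-! ### Combined forests -/

/-- The data of a combined forest: the triple `(μ, ν, λ)` and the `r`-tuple `(F_1, …, F_r)` of VEV
forests. The bridges are determined by these. -/
structure CombForest (r : ℕ) where
  rset : Triple r
  forest : Fin r → List VTree

namespace CombForest

variable {r : ℕ}

/-- `W_(k)`: all labels are multiplied by `k`. -/
def scale (k : ℕ) (W : CombForest r) : CombForest r where
  rset := W.rset.scale k
  forest i := (W.forest i).map (VTree.scale k)

/-- The bridges: one for every part `λ^i_j`. -/
abbrev Bridge (W : CombForest r) : Type := (i : Fin r) × Fin (W.rset.lam i).length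

/-- The label `h(b)` of a bridge. -/
def h (W : CombForest r) (b : W.Bridge) : ℕ := (W.rset.lam b.1).get b.2

/-- The leaf index of the left leaf of `F_i` associated to `λ^i_j`. The left leaves carry the parts
of `μ^i ∪ λ^i`, the largest one at the right; among equal parts the outer (left) leaves come from
`λ^i` and the inner ones from `μ^i`. Hence `λ^i_j` (`j` counted from `0`) is preceded in
`μ^i ∪ λ^i` by `j` parts of `λ^i` and by all parts of `μ^i` that are at least `λ^i_j`. -/
def leftIdx (W : CombForest r) (b : W.Bridge) : ℕ :=
  ((W.rset.mu b.1).length + (W.rset.lam b.1).length) - 1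
    - ((b.2 : ℕ) + (W.rset.mu b.1).countP (fun x => decide (W.h b ≤ x)))

/-- The leaf index of the right leaf of `F_{i-1}` associated to `λ^i_j`. The right leaves carry the
parts of `ν^{i-1} ∪ λ^i`, the largest one at the left; among equal parts the outer (right) leaves
come from `λ^i` and the inner ones from `ν^{i-1}`. -/
def rightIdx [NeZero r] (W : CombForest r) (b : W.Bridge) : ℕ :=
  ((W.rset.mu (b.1 - 1)).length + (W.rset.lam (b.1 - 1)).length)
    + ((b.2 : ℕ) + (W.rset.nu (b.1 - 1)).countP (fun x => decide (W.h b ≤ x)))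

/-- The vertices of a combined forest: the vertices of the trees in the forests `F_i`. -/
abbrev Vertex (W : CombForest r) : Type :=
  {v : Fin r × VTree // ∃ T ∈ W.forest v.1, v.2 ∈ T.subtrees}

/-- The bridge `b` joins the leaf `v` of `F_{i-1}` and the leaf `u` of `F_i`. -/
def BridgeJoins [NeZero r] (W : CombForest r) (b : W.Bridge) (u v : W.Vertex) : Prop :=
  (∃ c n, u.1 = (b.1, VTree.leaf (W.leftIdx b) c n)) ∧
    ∃ c n, v.1 = (b.1 - 1, VTree.leaf (W.rightIdx b) c n)

/-- The underlying graph of a combined forest. Its edges are the edges of the trees in the forests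
`F_i` and the bridges. -/
def graph [NeZero r] (W : CombForest r) : SimpleGraph W.Vertex :=
  SimpleGraph.fromRel fun u v =>
    (u.1.1 = v.1.1 ∧ u.1.2.IsUpper v.1.2) ∨ ∃ b, W.BridgeJoins b u v

/-- The cycle rank `β(W) = #E - #V + 1` (of a connected combined forest). -/
def cycleRank [NeZero r] (W : CombForest r) : ℤ :=
  (Nat.card W.graph.edgeSet : ℤ) - (Nat.card W.Vertex : ℤ) + 1

/-- `L_1(W) = l(μ) + l(ν)`. -/
def L1 (W : CombForest r) : ℤ := (W.rset.lenMu : ℤ) + W.rset.lenNu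

/-- `L_2(W) = γ · d`, with `d` the degree. -/
def L2 (γ : Fin r → ℤ) (W : CombForest r) : ℤ := ∑ i, γ i * (W.rset.degree i : ℤ)

/-- `l(μ) + l(ν) + l(λ) - 1`. -/
def expo (W : CombForest r) : ℤ :=
  (W.rset.lenMu : ℤ) + W.rset.lenNu + W.rset.lenLam - 1

/-- The combined amplitude `𝓗(W)`. -/
def ampH (γ : Fin r → ℤ) (W : CombForest r) : K :=
  (-1 : K) ^ (W.L1 + W.L2 γ)
    * (∏ i, ((W.forest i).map VTree.ampB).prod)
    * ∏ b : W.Bridge, qnum (W.h b : ℤ) ^ 2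

/-- The trees in `F_i` of type I: `m(T)` and `n_root` are both odd. -/
def typeI (W : CombForest r) (i : Fin r) : List VTree :=
  (W.forest i).filter fun T => decide (Odd T.m ∧ Odd T.n)

/-- `𝓖_k(W)`. -/
def ampG (γ : Fin r → ℤ) (k : ℕ) (W : CombForest r) : K :=
  ∑ k' ∈ k.divisors,
    ((ArithmeticFunction.moebius (k / k') : ℤ) : K) * (k' : K) ^ (-W.expo)
      * subst (k / k') ((W.scale k').ampH γ)

end CombForest

/-- `Comb_γ^•(μ, ν, λ)`: the combined forests built from
`F_i ∈ Graph^•_{γ_i + 2}(μ^i ∪ λ^i, ν^i ∪ λ^{i+1})`. -/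
def comb {r : ℕ} [NeZero r] (γ : Fin r → ℤ) (S : Triple r) : Set (CombForest r) :=
  {W | W.rset = S ∧ ∀ i, W.forest i ∈
    graphsOfPartitions (γ i + 2) (ptnUnion (S.mu i) (S.lam i))
      (ptnUnion (S.nu i) (S.lam (i + 1)))}

/-- `Comb_γ^∘(μ, ν, λ)`: the connected combined forests. -/
def combConnected {r : ℕ} [NeZero r] (γ : Fin r → ℤ) (S : Triple r) : Set (CombForest r) :=
  {W | W ∈ comb γ S ∧ W.graph.Connected}

end TopString

end

/-!
The amplitude `𝓗(W)` of a connected combined forest has no pole except a simple one at `t = 0`, and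
scaling all labels by `k` multiplies it, up to the substitution `q → q^k`, by a product of factors
`[k ζ_v] / [ζ_v]`, which are known modulo `t`. Everything follows from these two facts.

*Poles.* Write `R = ℤ[q^{1/2}, q^{-1/2}]`. For a fixed `y` the integers `k` with `[k] y ∈ R` form a
subgroup of `ℤ`, so denominators can be treated by gcds of integers, without factoring into
cyclotomic polynomials. An induction on the tree gives `[m(T)]² 𝓑(T) ∈ R` for each VEV tree `T`
(`VTree.qnum_m_sq_mul_ampB_mem`). The induction needs a stronger statement
(`VTree.qnum_m_sq_mul_zetaQuot_div_mem`), since a divisor of the root label that does not divide the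
leaf labels has to be cancelled by an additional `[ζ_v]`. In a connected `W` every tree `T` other
than a chosen `T₀` can be assigned its own bridge `b`, with `m(T) ∣ h(b)`, so that the factors
`[h(b)]²` cancel the poles of all trees but `T₀` (`CombForest.exists_bridge_assignment`). As `T₀` is
arbitrary and the gcd of all `m(T)` is `1`, the product `t 𝓗(W)` lies in `R`
(`CombForest.t_mul_core_mem`). It is invariant under `q^{1/2} ↦ q^{-1/2}` and `q^{1/2} ↦ -q^{1/2}`,
hence it is in `ℤ[t]` (`mem_intT_of_fixed`).

*Scaling.* Modulo `t`, a factor `[k ζ] / [ζ]` is `k`, except that it is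
`(k/2) (q^{1/2} + q^{-1/2})` for even `k` and odd `ζ`. The number of odd `ζ_v` in a tree has the
parity of `n_root`, which yields the type I correction (`VTree.congT_qfacProd`). The number of all
factors is `l(μ) + l(ν) + l(λ) - 1` because the cycle rank is `0` (`CombForest.expo_eq`). Replacing
the factors by their residues modulo `t` changes the amplitude by a polynomial, as its pole is
`1 / t` (`CombForest.exists_core_scale_eq`); this is the first half of the theorem.

*The combination `𝓖_k`.* Up to polynomials the summand for `k'` only depends on the parity of `k'`,
and the sums of Möbius values cancel for `k > 2`. For `k = 2` the amplitude contributes the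
denominator `t_2 = t (t + 4)`, and the factor `t + 4` disappears because the correction factor is
`(-1)^{L_2}` at `t = -4` (`CombForest.exists_subst_totalType_two`).
-/

noncomputable section

namespace TopString

open Polynomial

/-! ### Laurent polynomials in `q^{1/2}` with integer coefficients -/

/-- The variable `q^{1/2}`. -/
abbrev x : K := RatFunc.X

lemma x_ne : x ≠ 0 := RatFunc.X_ne_zero

/-- The ring `ℤ[q^{1/2}, q^{-1/2}]`, as a subring of `K`. -/
def laurentRing : Subring K := Subring.closure {x, x⁻¹}

lemma x_zpow_mem (a : ℤ) : x ^ a ∈ laurentRing := by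
  have h1 : x ∈ laurentRing := Subring.subset_closure (by simp)
  have h2 : x⁻¹ ∈ laurentRing := Subring.subset_closure (by simp)
  cases a with
  | ofNat n => simpa using pow_mem h1 n
  | negSucc n => rw [zpow_negSucc, ← inv_pow]; exact pow_mem h2 _

lemma qnum_mem (a : ℤ) : qnum a ∈ laurentRing := sub_mem (x_zpow_mem _) (x_zpow_mem _)

lemma t_mem : t ∈ laurentRing := pow_mem (qnum_mem _) 2

lemma t_eq : t = (x - x⁻¹) ^ 2 := by simp [t, tk, qnum]

lemma qnum_zero : qnum 0 = 0 := by simp [qnum]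

lemma qnum_neg (a : ℤ) : qnum (-a) = -qnum a := by simp [qnum]

lemma qnum_add (a b : ℤ) : qnum (a + b) = x ^ b * qnum a + x ^ (-a) * qnum b := by
  simp only [qnum, mul_sub, ← zpow_add₀ x_ne]
  ring_nf

/-! ### Substitutions for `q^{1/2}` -/

/-- There are two propositionally equal `ℚ`-algebra structures on `K` around; this is for the one
that comes from the characteristic. -/
lemma transcendental_x : Transcendental ℚ x := by
  rw [Subsingleton.elim (DivisionRing.toRatAlgebra : Algebra ℚ K)
    (RatFunc.instAlgebraOfPolynomial ℚ ℚ)]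
  exact RatFunc.transcendental_X

lemma eval₂_injective_of_transcendental {y : K} (h : Transcendental ℚ y) :
    Function.Injective (eval₂RingHom (Rat.castHom K) y) :=
  transcendental_iff_injective.1 h

/-- The endomorphism of the field `K` with `q^{1/2} ↦ y`, for `y` transcendental over `ℚ`. -/
def evalHom (y : K) (hy : Function.Injective (eval₂RingHom (Rat.castHom K) y)) : K →+* K :=
  RatFunc.liftRingHom (eval₂RingHom (Rat.castHom K) y)
    (nonZeroDivisors_le_comap_nonZeroDivisors_of_injective _ hy)

lemma x_injective : Function.Injective (eval₂RingHom (Rat.castHom K) x) :=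
  eval₂_injective_of_transcendental transcendental_x

lemma x_pow_injective {k : ℕ} (hk : 0 < k) :
    Function.Injective (eval₂RingHom (Rat.castHom K) (x ^ k)) :=
  eval₂_injective_of_transcendental (transcendental_x.pow hk)

lemma x_inv_injective : Function.Injective (eval₂RingHom (Rat.castHom K) x⁻¹) :=
  eval₂_injective_of_transcendental
    fun h => transcendental_x (IsAlgebraic.inv_iff.1 h)

lemma neg_x_injective : Function.Injective (eval₂RingHom (Rat.castHom K) (-x)) :=
  eval₂_injective_of_transcendental
    fun h => transcendental_x (by simpa using h.neg)

lemma evalHom_x (y : K) (hy) : evalHom y hy x = y := by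
  rw [evalHom, RatFunc.liftRingHom_apply]
  simp

lemma evalHom_x_zpow (y : K) (hy) (a : ℤ) :
    evalHom y hy (x ^ a) = y ^ a := by
  rw [map_zpow₀, evalHom_x]

/-- The substitution `q^{1/2} ↦ q^{-1/2}`. -/
def invHom : K →+* K := evalHom x⁻¹ x_inv_injective

/-- The substitution `q^{1/2} ↦ -q^{1/2}`. -/
def negHom : K →+* K := evalHom (-x) neg_x_injective

/-- The substitution `q^{1/2} ↦ q^{k/2}`. -/
def powHom (k : ℕ) (hk : 0 < k) : K →+* K := evalHom (x ^ k) (x_pow_injective hk)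

lemma subst_eq_powHom (k : ℕ) (hk : 0 < k) (u : K) : subst k u = powHom k hk u := by
  rw [powHom, evalHom, RatFunc.liftRingHom_apply, subst, RatFunc.eval,
    Subsingleton.elim (algebraMap ℚ K) (Rat.castHom K)]
  rfl

lemma invHom_x_zpow (a : ℤ) : invHom (x ^ a) = x ^ (-a) := by
  rw [invHom, evalHom_x_zpow, inv_zpow, zpow_neg]

lemma negHom_x_zpow (a : ℤ) : negHom (x ^ a) = (-1) ^ a * x ^ a := by
  rw [negHom, evalHom_x_zpow, neg_eq_neg_one_mul, mul_zpow]

lemma powHom_x_zpow {k : ℕ} (hk : 0 < k) (a : ℤ) : powHom k hk (x ^ a) = x ^ (k * a) := by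
  rw [powHom, evalHom_x_zpow, zpow_mul, zpow_natCast]

lemma invHom_qnum (a : ℤ) : invHom (qnum a) = -qnum a := by
  simp only [qnum, map_sub, invHom_x_zpow]; simp

lemma negHom_qnum (a : ℤ) : negHom (qnum a) = (-1) ^ a * qnum a := by
  simp only [qnum, map_sub, negHom_x_zpow]
  rw [zpow_neg (-1 : K), ← inv_zpow (-1 : K)]
  norm_num
  ring

lemma powHom_qnum {k : ℕ} (hk : 0 < k) (a : ℤ) : powHom k hk (qnum a) = qnum (k * a) := by
  simp only [qnum, map_sub, powHom_x_zpow]; simp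

lemma ringHom_ext_x {f g : K →+* K} (h : f x = g x) : f = g := by
  refine IsFractionRing.ringHom_ext (A := ℚ[X]) fun p => ?_
  have : f.comp (algebraMap ℚ[X] K) = g.comp (algebraMap ℚ[X] K) := by
    apply Polynomial.ringHom_ext'
    · exact Subsingleton.elim _ _
    · simpa using h
  exact DFunLike.congr_fun this p

lemma powHom_comp {k l : ℕ} (hk : 0 < k) (hl : 0 < l) (u : K) :
    powHom l hl (powHom k hk u) = powHom (k * l) (Nat.mul_pos hk hl) u := by
  have : (powHom l hl).comp (powHom k hk) = powHom (k * l) (Nat.mul_pos hk hl) := by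
    apply ringHom_ext_x
    simp [powHom, evalHom_x, ← pow_mul, mul_comm]
  exact DFunLike.congr_fun this u

lemma invHom_powHom {k : ℕ} (hk : 0 < k) (u : K) :
    invHom (powHom k hk u) = powHom k hk (invHom u) := by
  have : invHom.comp (powHom k hk) = (powHom k hk).comp invHom := by
    apply ringHom_ext_x
    simp [powHom, invHom, evalHom_x]
  exact DFunLike.congr_fun this u

lemma negHom_powHom_of_odd {k : ℕ} (hk : 0 < k) (h : Odd k) (u : K) :
    negHom (powHom k hk u) = powHom k hk (negHom u) := by
  have : negHom.comp (powHom k hk) = (powHom k hk).comp negHom := by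
    apply ringHom_ext_x
    simp [powHom, negHom, evalHom_x, h.neg_pow]
  exact DFunLike.congr_fun this u

lemma negHom_powHom_of_even {k : ℕ} (hk : 0 < k) (h : Even k) (u : K) :
    negHom (powHom k hk u) = powHom k hk u := by
  have : negHom.comp (powHom k hk) = powHom k hk := by
    apply ringHom_ext_x
    simp [powHom, negHom, evalHom_x, h.neg_pow]
  exact DFunLike.congr_fun this u

lemma powHom_mem {k : ℕ} (hk : 0 < k) {u : K} (hu : u ∈ laurentRing) :
    powHom k hk u ∈ laurentRing := by
  have : laurentRing ≤ laurentRing.comap (powHom k hk) := by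
    refine Subring.closure_le.2 ?_
    rintro y (rfl | rfl)
    · have := powHom_x_zpow hk 1
      rw [zpow_one] at this
      simpa only [SetLike.mem_coe, Subring.mem_comap, this] using x_zpow_mem _
    · have := powHom_x_zpow hk (-1)
      rw [zpow_neg_one] at this
      simpa only [SetLike.mem_coe, Subring.mem_comap, this] using x_zpow_mem _
  exact this hu

/-! ### Symmetric Laurent polynomials are polynomials in `t` -/

/-- The ring `ℤ[t]`. -/
def intT : Subring K := (eval₂RingHom (Int.castRingHom K) t).range

lemma aeval_t_eq (P : ℤ[X]) : aeval t P = eval₂RingHom (Int.castRingHom K) t P := by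
  rw [aeval_def, Subsingleton.elim (algebraMap ℤ K) (Int.castRingHom K)]; rfl

lemma mem_intT {u : K} : u ∈ intT ↔ ∃ P : ℤ[X], u = aeval t P := by
  simp only [intT, RingHom.mem_range, aeval_t_eq, eq_comm]

lemma map_aeval_t (f : K →+* K) (P : ℤ[X]) :
    f (aeval t P) = eval₂RingHom (Int.castRingHom K) (f t) P := by
  rw [aeval_t_eq, coe_eval₂RingHom, hom_eval₂, Subsingleton.elim (f.comp _) (Int.castRingHom K)]
  rfl

lemma t_mem_intT : t ∈ intT := mem_intT.2 ⟨X, by simp⟩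

lemma invHom_t : invHom t = t := by simp [t, tk, invHom_qnum]

lemma negHom_t : negHom t = t := by simp [t, tk, negHom_qnum]

lemma powHom_t {k : ℕ} (hk : 0 < k) : powHom k hk t = tk k := by
  simp [t, tk, powHom_qnum]

lemma x_sub_inv_ne : x - x⁻¹ ≠ 0 := by
  intro h
  have h2 : x * x = 1 := by
    rw [sub_eq_zero] at h
    nth_rewrite 1 [h]
    exact inv_mul_cancel₀ x_ne
  refine (monic_X_pow_sub_C (1 : ℚ) two_ne_zero).ne_zero (x_injective ?_)
  simp [pow_two, h2]

lemma qnum_ne {a : ℤ} (ha : a ≠ 0) : qnum a ≠ 0 := by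
  have key : ∀ k : ℕ, 0 < k → qnum (k : ℤ) ≠ 0 := by
    intro k hk h
    have := powHom_qnum hk 1
    rw [mul_one, h, map_eq_zero] at this
    exact x_sub_inv_ne (by simpa [qnum] using this)
  rcases Int.natAbs_eq a with h | h
  · rw [h]; exact key _ (by omega)
  · rw [h, qnum_neg, neg_ne_zero]; exact key _ (by omega)

lemma t_ne : t ≠ 0 := pow_ne_zero _ (qnum_ne (by simp))

/-- Every Laurent polynomial is `a + b q^{1/2}` with `a`, `b` polynomials in `s = q^{1/2} + q^{-1/2}`,
and the exchange of `q^{1/2}` and `q^{-1/2}` detects `b`; in the same way a polynomial in `s` is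
`a + b s` with `a`, `b` polynomials in `s² = t + 4`, and the change of sign of `q^{1/2}`
detects `b`. -/
lemma mem_intT_of_fixed {u : K} (hu : u ∈ laurentRing) (hi : invHom u = u) (hn : negHom u = u) :
    u ∈ intT := by
  have hxi : invHom x = x⁻¹ := evalHom_x _ _
  have hxn : negHom x = -x := evalHom_x _ _
  have hx : x * x⁻¹ = 1 := mul_inv_cancel₀ x_ne
  set s : K := x + x⁻¹ with hs
  let Rs : Subring K := Subring.closure {s}
  have hsi : invHom s = s := by rw [hs, map_add, map_inv₀, hxi, inv_inv, add_comm]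
  have hsn : negHom s = -s := by rw [hs, map_add, map_inv₀, hxn, inv_neg]; ring
  have hss : s * s = t + 4 := by rw [hs, t_eq]; linear_combination 4 * hx
  have hsm : s ∈ Rs := Subring.subset_closure rfl
  have hRs : ∀ a ∈ Rs, invHom a = a := by
    intro a ha
    have : Rs ≤ RingHom.eqLocus invHom (RingHom.id K) :=
      Subring.closure_le.2 (by rintro y rfl; exact hsi)
    exact this ha
  have h1 : ∀ v ∈ laurentRing, ∃ a ∈ Rs, ∃ b ∈ Rs, v = a + b * x := by
    intro v hv
    induction hv using Subring.closure_induction with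
    | mem y hy =>
      rcases hy with rfl | rfl
      · exact ⟨0, zero_mem _, 1, one_mem _, by ring⟩
      · exact ⟨s, hsm, -1, neg_mem (one_mem _), by rw [hs]; ring⟩
    | zero => exact ⟨0, zero_mem _, 0, zero_mem _, by ring⟩
    | one => exact ⟨1, one_mem _, 0, zero_mem _, by ring⟩
    | add y z _ _ hy hz =>
      obtain ⟨a, ha, b, hb, rfl⟩ := hy
      obtain ⟨c, hc, d, hd, rfl⟩ := hz
      exact ⟨a + c, add_mem ha hc, b + d, add_mem hb hd, by ring⟩
    | neg y _ hy =>
      obtain ⟨a, ha, b, hb, rfl⟩ := hy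
      exact ⟨-a, neg_mem ha, -b, neg_mem hb, by ring⟩
    | mul y z _ _ hy hz =>
      obtain ⟨a, ha, b, hb, rfl⟩ := hy
      obtain ⟨c, hc, d, hd, rfl⟩ := hz
      refine ⟨a * c - b * d, sub_mem (mul_mem ha hc) (mul_mem hb hd),
        a * d + b * c + b * d * s, add_mem (add_mem (mul_mem ha hd) (mul_mem hb hc))
          (mul_mem (mul_mem hb hd) hsm), ?_⟩
      rw [hs]; linear_combination (- (b * d)) * hx
  have h2 : ∀ v ∈ Rs, ∃ a ∈ intT, ∃ b ∈ intT, v = a + b * s := by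
    have h4 : (4 : K) ∈ intT := natCast_mem intT 4
    intro v hv
    induction hv using Subring.closure_induction with
    | mem y hy => rcases hy with rfl; exact ⟨0, zero_mem _, 1, one_mem _, by ring⟩
    | zero => exact ⟨0, zero_mem _, 0, zero_mem _, by ring⟩
    | one => exact ⟨1, one_mem _, 0, zero_mem _, by ring⟩
    | add y z _ _ hy hz =>
      obtain ⟨a, ha, b, hb, rfl⟩ := hy
      obtain ⟨c, hc, d, hd, rfl⟩ := hz
      exact ⟨a + c, add_mem ha hc, b + d, add_mem hb hd, by ring⟩
    | neg y _ hy =>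
      obtain ⟨a, ha, b, hb, rfl⟩ := hy
      exact ⟨-a, neg_mem ha, -b, neg_mem hb, by ring⟩
    | mul y z _ _ hy hz =>
      obtain ⟨a, ha, b, hb, rfl⟩ := hy
      obtain ⟨c, hc, d, hd, rfl⟩ := hz
      refine ⟨a * c + b * d * (t + 4), add_mem (mul_mem ha hc)
        (mul_mem (mul_mem hb hd) (add_mem t_mem_intT h4)), a * d + b * c,
        add_mem (mul_mem ha hd) (mul_mem hb hc), ?_⟩
      linear_combination b * d * hss
  have hT : ∀ a ∈ intT, negHom a = a := by
    intro a ha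
    obtain ⟨P, rfl⟩ := mem_intT.1 ha
    rw [map_aeval_t, negHom_t, aeval_t_eq]
  obtain ⟨a, ha, b, hb, rfl⟩ := h1 u hu
  have hb0 : b = 0 := by
    rw [map_add, map_mul, hRs a ha, hRs b hb, hxi] at hi
    have : b * (x - x⁻¹) = 0 := by linear_combination -hi
    exact (mul_eq_zero.1 this).resolve_right x_sub_inv_ne
  subst hb0
  obtain ⟨a', ha', b', hb', rfl⟩ := h2 a ha
  have hs0 : s ≠ 0 := by
    intro h0
    have h1 : (x - x⁻¹) ^ 2 = -4 := by
      rw [← t_eq]; linear_combination s * h0 - hss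
    refine (monic_X_pow_add_C (1 : ℚ) two_ne_zero).ne_zero (x_injective ?_)
    have h2 : x * (x + x⁻¹) = 0 := by rw [← hs, h0, mul_zero]
    simp only [coe_eval₂RingHom, eval₂_add, eval₂_X_pow, map_one, eval₂_one, eval₂_zero]
    linear_combination h2 - hx
  have hb0 : b' = 0 := by
    rw [zero_mul, add_zero, map_add, map_mul, hT a' ha', hT b' hb', hsn] at hn
    have : (2 * b') * s = 0 := by linear_combination -hn
    simpa using (mul_eq_zero.1 this).resolve_right hs0
  subst hb0
  simpa using ha'

lemma zpow_add_zpow_neg (a : ℤ) : x ^ (2 * a) + x ^ (-(2 * a)) = qnum a ^ 2 + 2 := by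
  have : x ^ a * x ^ (-a) = 1 := by rw [← zpow_add₀ x_ne]; simp
  rw [qnum, show -(2 * a) = (-a) + (-a) by ring, two_mul,
    zpow_add₀ x_ne, zpow_add₀ x_ne]
  linear_combination 2 * this

/-- For `k > 0`, `t_k` is a monic polynomial in `t`: the polynomials for `q^k + q^{-k}` satisfy
the Chebyshev recursion. -/
lemma exists_monic_tk {k : ℕ} (hk : 0 < k) : ∃ P : ℤ[X], P.Monic ∧ tk k = aeval t P := by
  have hC : aeval t (C 2 : ℤ[X]) = (2 : K) := by rw [aeval_t_eq]; simp
  have key : ∀ k : ℕ, ∃ A B : ℤ[X], A.Monic ∧ A.natDegree = k + 1 ∧ B.natDegree ≤ k ∧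
      aeval t A = x ^ (2 * (k + 1 : ℤ)) + x ^ (-(2 * (k + 1 : ℤ))) ∧
      aeval t B = x ^ (2 * (k : ℤ)) + x ^ (-(2 * (k : ℤ))) := by
    intro k
    have hx : x * x⁻¹ = 1 := mul_inv_cancel₀ x_ne
    have h2x : t + 2 = x ^ (2 : ℤ) + x ^ (-2 : ℤ) := by
      rw [t_eq, zpow_neg, ← inv_zpow]
      norm_cast
      linear_combination - 2 * hx
    induction k with
    | zero =>
      refine ⟨X + C 2, C 2, monic_X_add_C 2, natDegree_X_add_C 2, by simp, ?_, ?_⟩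
      · rw [map_add, aeval_X, hC]; simpa using h2x
      · rw [hC]; norm_num
    | succ k ih =>
      obtain ⟨A, B, hA, hAd, hBd, hAe, hBe⟩ := ih
      have hm : ((X + C 2) * A).Monic := (monic_X_add_C 2).mul hA
      have hd : ((X + C 2) * A).natDegree = k + 2 := by
        rw [(monic_X_add_C 2).natDegree_mul hA, natDegree_X_add_C, hAd]; ring
      have hlt : B.degree < ((X + C 2) * A).degree := by
        apply degree_lt_degree; omega
      refine ⟨(X + C 2) * A - B, A, hm.sub_of_left hlt, ?_, by omega, ?_, ?_⟩
      · rw [natDegree_sub_eq_left_of_natDegree_lt (by omega), hd]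
      · rw [map_sub, map_mul, hAe, hBe]
        have : aeval t (X + C 2 : ℤ[X]) = t + 2 := by rw [map_add, aeval_X, hC]
        rw [this, h2x, add_mul (x ^ (2 : ℤ)), mul_add (x ^ (2 : ℤ)), mul_add (x ^ (-2 : ℤ))]
        simp only [← zpow_add₀ x_ne]
        push_cast
        rw [show 2 + 2 * ((k : ℤ) + 1) = 2 * (k + 1 + 1) by ring,
          show 2 + -(2 * ((k : ℤ) + 1)) = -(2 * k) by ring,
          show -2 + 2 * ((k : ℤ) + 1) = 2 * k by ring,
          show -2 + -(2 * ((k : ℤ) + 1)) = -(2 * (k + 1 + 1)) by ring]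
        ring
      · rw [hAe]; push_cast; rfl
  obtain ⟨k, rfl⟩ : ∃ j, k = j + 1 := ⟨k - 1, by omega⟩
  obtain ⟨A, B, hA, hAd, -, hAe, -⟩ := key k
  refine ⟨A - C 2, hA.sub_of_left ?_, ?_⟩
  · apply degree_lt_degree; simp [hAd]
  · rw [map_sub, hAe]
    rw [zpow_add_zpow_neg, hC]; simp [tk]

lemma powHom_mem_intT {k : ℕ} (hk : 0 < k) {u : K} (hu : u ∈ intT) : powHom k hk u ∈ intT := by
  obtain ⟨P, rfl⟩ := mem_intT.1 hu
  obtain ⟨A, -, hA⟩ := exists_monic_tk hk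
  refine mem_intT.2 ⟨P.comp A, ?_⟩
  rw [map_aeval_t, aeval_t_eq, powHom_t, hA, aeval_t_eq]
  simp [eval₂_comp]

/-! ### Divisibility of `q`-numbers -/

/-- The integers `k` with `[k] y` a Laurent polynomial form a subgroup. -/
lemma qnum_gcd_mul_mem {a b : ℤ} {y : K} (ha : qnum a * y ∈ laurentRing)
    (hb : qnum b * y ∈ laurentRing) : qnum (Int.gcd a b) * y ∈ laurentRing := by
  let G : AddSubgroup ℤ :=
    { carrier := {k | qnum k * y ∈ laurentRing}
      zero_mem' := by simp [qnum_zero, zero_mem]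
      add_mem' := by
        intro c d hc hd
        have : qnum (c + d) * y = x ^ d * (qnum c * y) + x ^ (-c) * (qnum d * y) := by
          rw [qnum_add]; ring
        simp only [Set.mem_ofPred_eq] at hc hd ⊢
        rw [this]
        exact add_mem (mul_mem (x_zpow_mem _) hc) (mul_mem (x_zpow_mem _) hd)
      neg_mem' := by
        intro c hc
        simp only [Set.mem_ofPred_eq] at hc ⊢
        rw [qnum_neg, neg_mul]
        exact neg_mem hc }
  have hG : (Int.gcd a b : ℤ) ∈ G := by
    rw [Int.gcd_eq_gcd_ab, mul_comm a, mul_comm b, ← smul_eq_mul, ← smul_eq_mul]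
    exact add_mem (zsmul_mem (K := G) (show a ∈ G from ha) _)
      (zsmul_mem (K := G) (show b ∈ G from hb) _)
  exact hG

lemma exists_qnum_eq_mul {a b : ℤ} (h : a ∣ b) : ∃ r ∈ laurentRing, qnum b = qnum a * r := by
  rcases eq_or_ne a 0 with rfl | ha
  · rw [zero_dvd_iff.1 h]; exact ⟨0, zero_mem _, by simp [qnum_zero]⟩
  · have hq := qnum_ne ha
    have h1 : qnum a * (qnum a)⁻¹ ∈ laurentRing := by rw [mul_inv_cancel₀ hq]; exact one_mem _
    obtain ⟨c, rfl⟩ := h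
    have : ∀ c : ℕ, qnum (a * c) * (qnum a)⁻¹ ∈ laurentRing := by
      intro c
      induction c with
      | zero => simp [qnum_zero, zero_mem]
      | succ c ih =>
        rw [Nat.cast_succ, mul_add, mul_one, qnum_add, add_mul, mul_assoc, mul_assoc]
        exact add_mem (mul_mem (x_zpow_mem _) ih) (mul_mem (x_zpow_mem _) h1)
    have h2 : qnum (a * c) * (qnum a)⁻¹ ∈ laurentRing := by
      rcases Int.natAbs_eq c with hc | hc
      · rw [hc]; exact this _
      · rw [hc, mul_neg, qnum_neg, neg_mul]; exact neg_mem (this _)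
    exact ⟨_, h2, by field_simp⟩

lemma qnum_mul_mem_of_dvd {a b : ℤ} (h : a ∣ b) {y : K} (ha : qnum a * y ∈ laurentRing) :
    qnum b * y ∈ laurentRing := by
  obtain ⟨r, hr, e⟩ := exists_qnum_eq_mul h
  rw [e, mul_right_comm]
  exact mul_mem ha hr

lemma qnum_div_mem {a b : ℤ} (h : a ∣ b) : qnum b / qnum a ∈ laurentRing := by
  obtain ⟨r, hr, e⟩ := exists_qnum_eq_mul h
  rcases eq_or_ne (qnum a) 0 with h0 | h0
  · rw [h0, div_zero]; exact zero_mem _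
  · rw [e, mul_div_cancel_left₀ _ h0]; exact hr

lemma qnum_gcd_sq_mul_mem {a b : ℤ} {y : K} (ha : qnum a ^ 2 * y ∈ laurentRing)
    (hab : qnum a * qnum b * y ∈ laurentRing) (hb : qnum b ^ 2 * y ∈ laurentRing) :
    qnum (Int.gcd a b) ^ 2 * y ∈ laurentRing := by
  have h1 : qnum (Int.gcd a b) * (qnum a * y) ∈ laurentRing :=
    qnum_gcd_mul_mem (by convert ha using 1; ring) (by convert hab using 1; ring)
  have h2 : qnum (Int.gcd a b) * (qnum b * y) ∈ laurentRing :=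
    qnum_gcd_mul_mem (by convert hab using 1; ring) (by convert hb using 1; ring)
  have h3 : qnum (Int.gcd a b) * (qnum (Int.gcd a b) * y) ∈ laurentRing :=
    qnum_gcd_mul_mem (by convert h1 using 1; ring) (by convert h2 using 1; ring)
  convert h3 using 1; ring

lemma exists_qnum_gcd (a b : ℤ) : ∃ α ∈ laurentRing, ∃ β ∈ laurentRing,
    qnum (Int.gcd a b) = α * qnum a + β * qnum b := by
  let G : AddSubgroup ℤ :=
    { carrier := {k | ∃ α ∈ laurentRing, ∃ β ∈ laurentRing, qnum k = α * qnum a + β * qnum b}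
      zero_mem' := ⟨0, zero_mem _, 0, zero_mem _, by simp [qnum_zero]⟩
      add_mem' := by
        rintro c d ⟨α, hα, β, hβ, h⟩ ⟨α', hα', β', hβ', h'⟩
        refine ⟨x ^ d * α + x ^ (-c) * α', add_mem (mul_mem (x_zpow_mem _) hα)
          (mul_mem (x_zpow_mem _) hα'), x ^ d * β + x ^ (-c) * β',
          add_mem (mul_mem (x_zpow_mem _) hβ) (mul_mem (x_zpow_mem _) hβ'), ?_⟩
        rw [qnum_add, h, h']; ring
      neg_mem' := by
        rintro c ⟨α, hα, β, hβ, h⟩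
        exact ⟨-α, neg_mem hα, -β, neg_mem hβ, by rw [qnum_neg, h]; ring⟩ }
  have ha : a ∈ G := ⟨1, one_mem _, 0, zero_mem _, by ring⟩
  have hb : b ∈ G := ⟨0, zero_mem _, 1, one_mem _, by ring⟩
  have hG : (Int.gcd a b : ℤ) ∈ G := by
    rw [Int.gcd_eq_gcd_ab, mul_comm a, mul_comm b, ← smul_eq_mul, ← smul_eq_mul]
    exact add_mem (zsmul_mem (K := G) ha _) (zsmul_mem (K := G) hb _)
  exact hG

/-- The quotients of `[a]` and `[b]` by `[gcd(a, b)]` generate the unit ideal, hence so do their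
squares. -/
lemma qnum_gcd_sq_mul_mem' {a b : ℤ} {y : K} (ha : qnum a ^ 2 * y ∈ laurentRing)
    (hb : qnum b ^ 2 * y ∈ laurentRing) : qnum (Int.gcd a b) ^ 2 * y ∈ laurentRing := by
  rcases eq_or_ne (Int.gcd a b) 0 with h0 | h0
  · simp [h0, qnum_zero, zero_mem]
  have hq : qnum (Int.gcd a b) ≠ 0 := qnum_ne (by exact_mod_cast h0)
  obtain ⟨A, hA, eA⟩ := exists_qnum_eq_mul (Int.gcd_dvd_left a b)
  obtain ⟨B, hB, eB⟩ := exists_qnum_eq_mul (Int.gcd_dvd_right a b)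
  obtain ⟨α, hα, β, hβ, e⟩ := exists_qnum_gcd a b
  set g := qnum (Int.gcd a b)
  have h1 : α * A + β * B = 1 := by
    apply mul_left_cancel₀ hq
    rw [eA, eB] at e
    linear_combination -e
  have e2 : g ^ 2 * y = (α ^ 3 * A + 3 * α ^ 2 * β * B) * (qnum a ^ 2 * y) +
      (3 * α * β ^ 2 * A + β ^ 3 * B) * (qnum b ^ 2 * y) := by
    have : (α * A + β * B) ^ 3 = 1 := by rw [h1, one_pow]
    rw [eA, eB]
    linear_combination - g ^ 2 * y * this
  have h3 : (3 : K) ∈ laurentRing := natCast_mem _ 3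
  rw [e2]
  refine add_mem (mul_mem (add_mem ?_ ?_) ha) (mul_mem (add_mem ?_ ?_) hb)
  · exact mul_mem (pow_mem hα _) hA
  · exact mul_mem (mul_mem (mul_mem h3 (pow_mem hα _)) hβ) hB
  · exact mul_mem (mul_mem (mul_mem h3 hα) (pow_mem hβ _)) hA
  · exact mul_mem (pow_mem hβ _) hB

/-! ### Congruences modulo `t` -/

/-- `u ≡ v` modulo `t` in the ring of Laurent polynomials. -/
def CongT (u v : K) : Prop := v ∈ laurentRing ∧ ∃ d ∈ laurentRing, u = v + t * d

namespace CongT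

lemma refl {u : K} (hu : u ∈ laurentRing) : CongT u u := ⟨hu, 0, zero_mem _, by ring⟩

lemma left_mem {u v : K} (h : CongT u v) : u ∈ laurentRing := by
  obtain ⟨hv, d, hd, rfl⟩ := h
  exact add_mem hv (mul_mem t_mem hd)

lemma symm {u v : K} (h : CongT u v) : CongT v u := by
  refine ⟨h.left_mem, ?_⟩
  obtain ⟨hv, d, hd, rfl⟩ := h
  exact ⟨-d, neg_mem hd, by ring⟩

lemma trans {u v w : K} (h : CongT u v) (h' : CongT v w) : CongT u w := by
  obtain ⟨-, d, hd, rfl⟩ := h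
  obtain ⟨hw, d', hd', rfl⟩ := h'
  exact ⟨hw, d' + d, add_mem hd' hd, by ring⟩

lemma add {u v u' v' : K} (h : CongT u v) (h' : CongT u' v') : CongT (u + u') (v + v') := by
  obtain ⟨hv, d, hd, rfl⟩ := h
  obtain ⟨hv', d', hd', rfl⟩ := h'
  exact ⟨add_mem hv hv', d + d', add_mem hd hd', by ring⟩

lemma mul {u v u' v' : K} (h : CongT u v) (h' : CongT u' v') : CongT (u * u') (v * v') := by
  obtain ⟨hv, d, hd, rfl⟩ := h
  obtain ⟨hv', d', hd', rfl⟩ := h'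
  exact ⟨mul_mem hv hv', d * v' + v * d' + t * (d * d'),
    add_mem (add_mem (mul_mem hd hv') (mul_mem hv hd')) (mul_mem t_mem (mul_mem hd hd')), by ring⟩

lemma list_prod {α : Type*} (L : List α) {f g : α → K} (h : ∀ a ∈ L, CongT (f a) (g a)) :
    CongT (L.map f).prod (L.map g).prod := by
  induction L with
  | nil => simpa using refl (one_mem _)
  | cons a L ih =>
    simp only [List.map_cons, List.prod_cons]
    exact (h a (by simp)).mul (ih fun b hb => h b (by simp [hb]))

lemma finset_prod {α : Type*} (s : Finset α) {f g : α → K} (h : ∀ a ∈ s, CongT (f a) (g a)) :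
    CongT (∏ a ∈ s, f a) (∏ a ∈ s, g a) := by
  simpa [Finset.prod_map_toList] using list_prod s.toList (f := f) (g := g) (by simpa using h)

end CongT

/-- The common residue modulo `t` of `q^{a/2} + q^{-a/2}` for all `a` of the same parity. -/
def parityResidue (a : ℤ) : K := if Even a then 2 else x + x⁻¹

lemma x_add_inv_mem : x + x⁻¹ ∈ laurentRing := by
  simpa using add_mem (x_zpow_mem 1) (x_zpow_mem (-1))

lemma parityResidue_mem (a : ℤ) : parityResidue a ∈ laurentRing := by
  unfold parityResidue
  split_ifs
  · exact natCast_mem _ 2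
  · exact x_add_inv_mem

lemma exists_qnum_mul_qnum (a b : ℤ) : ∃ d ∈ laurentRing, qnum a * qnum b = t * d := by
  obtain ⟨r, hr, er⟩ := exists_qnum_eq_mul (one_dvd a)
  obtain ⟨s, hs, es⟩ := exists_qnum_eq_mul (one_dvd b)
  exact ⟨r * s, mul_mem hr hs, by rw [er, es, t, tk]; push_cast; ring⟩

lemma congT_zpow_add_zpow_neg (a : ℤ) : CongT (x ^ a + x ^ (-a)) (parityResidue a) := by
  refine ⟨parityResidue_mem a, ?_⟩
  rcases Int.even_or_odd' a with ⟨b, rfl | rfl⟩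
  · obtain ⟨d, hd, e⟩ := exists_qnum_mul_qnum b b
    refine ⟨d, hd, ?_⟩
    rw [parityResidue, if_pos (even_two_mul b), ← e, zpow_add_zpow_neg]
    ring
  · obtain ⟨d, hd, e⟩ := exists_qnum_mul_qnum b (b + 1)
    refine ⟨d, hd, ?_⟩
    rw [parityResidue, if_neg (by simp), ← e, qnum, qnum, sub_mul, mul_sub, mul_sub]
    simp only [← zpow_add₀ x_ne]
    rw [show b + (b + 1) = 2 * b + 1 by ring, show b + -(b + 1) = -1 by ring,
      show -b + (b + 1) = 1 by ring, show -b + -(b + 1) = -(2 * b + 1) by ring]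
    rw [zpow_neg_one, zpow_one]; ring

lemma congT_parityResidue_mul (a b : ℤ) :
    CongT (parityResidue a * parityResidue b) (2 * parityResidue (a + b)) := by
  have h2 : (2 : K) ∈ laurentRing := natCast_mem _ 2
  refine ⟨mul_mem h2 (parityResidue_mem _), ?_⟩
  by_cases ha : Even a <;> by_cases hb : Even b
  · exact ⟨0, zero_mem _, by simp [parityResidue, ha, hb, Int.even_add]⟩
  · exact ⟨0, zero_mem _, by simp [parityResidue, ha, hb, Int.even_add]⟩
  · exact ⟨0, zero_mem _, by simp [parityResidue, ha, hb, Int.even_add, mul_comm]⟩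
  · refine ⟨1, one_mem _, ?_⟩
    have hx : x * x⁻¹ = 1 := mul_inv_cancel₀ x_ne
    simp only [parityResidue, ha, hb, Int.even_add, t_eq]
    simp only [if_false, if_true]
    linear_combination 4 * hx

/-- `[k a] / [a]` as a Laurent polynomial; it makes sense for `a = 0`, too. -/
def qfac : ℕ → ℤ → K
  | 0, _ => 0
  | 1, _ => 1
  | k + 2, a => qfac k a + (x ^ ((k + 1) * a) + x ^ (-((k + 1) * a)))

lemma qnum_mul_eq (k : ℕ) (a : ℤ) : qnum (k * a) = qnum a * qfac k a := by
  induction k using Nat.twoStepInduction with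
  | zero => simp [qfac, qnum_zero]
  | one => simp [qfac]
  | more k ih _ =>
    rw [qfac, mul_add, ← ih]
    simp only [qnum, mul_add, sub_mul, ← zpow_add₀ x_ne]
    push_cast
    rw [show a + (k + 1) * a = (k + 2) * a by ring, show -a + (k + 1) * a = k * a by ring,
      show a + -((k + 1) * a) = -(k * a) by ring,
      show -a + -((k + 1) * a) = -((k + 2) * a) by ring]
    ring

lemma qfac_zero_right (k : ℕ) : qfac k 0 = k := by
  induction k using Nat.twoStepInduction with
  | zero => simp [qfac]
  | one => simp [qfac]
  | more k ih _ => rw [qfac, ih]; push_cast; simp; ring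

lemma invHom_qfac (k : ℕ) (a : ℤ) : invHom (qfac k a) = qfac k a := by
  induction k using Nat.twoStepInduction with
  | zero => simp [qfac]
  | one => simp [qfac]
  | more k ih _ => rw [qfac, map_add, ih, map_add, invHom_x_zpow, invHom_x_zpow, neg_neg]; ring

lemma negHom_qfac_of_odd {k : ℕ} (hk : Odd k) (a : ℤ) : negHom (qfac k a) = qfac k a := by
  induction k using Nat.twoStepInduction with
  | zero => simp at hk
  | one => simp [qfac]
  | more k ih _ =>
    have hk' : Odd k := by simpa [Nat.odd_add] using hk
    have hev : Even (((k : ℤ) + 1) * a) := by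
      apply Even.mul_right
      exact_mod_cast hk'.add_one
    rw [qfac, map_add, ih hk', map_add, negHom_x_zpow, negHom_x_zpow, hev.neg_one_zpow,
      hev.neg.neg_one_zpow]
    ring

lemma congT_qfac_odd {k : ℕ} (hk : Odd k) (a : ℤ) : CongT (qfac k a) k := by
  induction k using Nat.twoStepInduction with
  | zero => simp at hk
  | one => simpa [qfac] using CongT.refl (one_mem _)
  | more k ih _ =>
    have hk' : Odd k := by simpa [Nat.odd_add] using hk
    have hev : Even (((k : ℤ) + 1) * a) := by
      apply Even.mul_right
      exact_mod_cast hk'.add_one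
    have h := congT_zpow_add_zpow_neg (((k : ℤ) + 1) * a)
    rw [parityResidue, if_pos hev] at h
    simpa [qfac] using (ih hk').add h

lemma congT_qfac_even (b : ℕ) (a : ℤ) : CongT (qfac (2 * b) a) (b * parityResidue a) := by
  induction b with
  | zero => simpa [qfac] using CongT.refl (zero_mem _)
  | succ b ih =>
    have h := congT_zpow_add_zpow_neg (((2 * b : ℕ) + 1 : ℤ) * a)
    have e : parityResidue (((2 * b : ℕ) + 1 : ℤ) * a) = parityResidue a := by
      have : ¬ Even (((2 * b : ℕ) : ℤ) + 1) := by
        rw [Int.not_even_iff_odd]; exact ⟨b, by push_cast; ring⟩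
      simp only [parityResidue, Int.even_mul, this, false_or]
    rw [e] at h
    have h3 := ih.add h
    rw [show (b : K) * parityResidue a + parityResidue a = ((b + 1 : ℕ) : K) * parityResidue a by
      push_cast; ring] at h3
    exact h3

lemma congT_qfac_even_prod (b : ℕ) (L : List ℤ) (hL : L ≠ []) :
    CongT (L.map (qfac (2 * b))).prod
      ((b : K) ^ L.length * 2 ^ (L.length - 1) * parityResidue L.sum) := by
  induction L with
  | nil => exact absurd rfl hL
  | cons a L ih =>
    rcases eq_or_ne L [] with rfl | hL'
    · simpa using congT_qfac_even b a
    have h1 := (congT_qfac_even b a).mul (ih hL')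
    have h2 := (CongT.refl (u := (b : K) ^ (L.length + 1) * 2 ^ (L.length - 1))
      (mul_mem (pow_mem (natCast_mem _ b) _) (pow_mem (natCast_mem _ 2) _))).mul
        (congT_parityResidue_mul a L.sum)
    have hlen : 0 < L.length := List.length_pos_iff.2 hL'
    have e : (2 : K) ^ L.length = 2 ^ (L.length - 1) * 2 := by
      rw [← pow_succ, Nat.sub_add_cancel hlen]
    simp only [List.map_cons, List.prod_cons, List.length_cons, List.sum_cons,
      Nat.add_sub_cancel]
    rw [e]
    refine (h1.trans (w := _) ?_)
    convert h2 using 1 <;> ring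

/-! ### Amplitudes of trees -/

namespace VTree

/-- The leaves of a tree, from left to right, each with its leaf index and its label `(c, n)`. -/
def leaves : VTree → List (ℕ × ℤ × ℤ)
  | leaf i c n => [(i, c, n)]
  | node l r => l.leaves ++ r.leaves

/-- The list of the `ζ_v`, the one of the root being the first. -/
def zetas : VTree → List ℤ
  | leaf _ _ _ => []
  | node l r => zeta l r :: (l.zetas ++ r.zetas)

/-- The properties of the leaf labels used in the analysis of the poles and parities. They hold
for the labels `(μ_j, 0)` and `(-ν_j, a ν_j)`. -/
def GoodLabels (T : VTree) : Prop :=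
  ∀ p ∈ T.leaves, p.2.1 ≠ 0 ∧ p.2.1 ∣ p.2.2 ∧ Even (p.2.2 + p.2.1 * p.2.2)

lemma GoodLabels.left {l r : VTree} (h : (node l r).GoodLabels) : l.GoodLabels :=
  fun p hp => h p (List.mem_append_left _ hp)

lemma GoodLabels.right {l r : VTree} (h : (node l r).GoodLabels) : r.GoodLabels :=
  fun p hp => h p (List.mem_append_right _ hp)

lemma length_leaves (T : VTree) : T.leaves.length = T.zetas.length + 1 := by
  induction T with
  | leaf => simp [leaves, zetas]
  | node l r hl hr => simp [leaves, zetas, hl, hr]; omega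

lemma zetaProd_eq (T : VTree) : T.zetaProd = (T.zetas.map qnum).prod := by
  induction T with
  | leaf => simp [zetaProd, zetas]
  | node l r hl hr => simp [zetaProd, zetas, hl, hr]

lemma m_dvd_leaf (T : VTree) {p : ℕ × ℤ × ℤ} (hp : p ∈ T.leaves) : (T.m : ℤ) ∣ p.2.1 := by
  induction T with
  | leaf i c n =>
    simp only [leaves, List.mem_singleton] at hp
    subst hp
    simp [m]
  | node l r hl hr =>
    rcases List.mem_append.1 hp with h | h
    · exact (Int.natCast_dvd_natCast.2 (Nat.gcd_dvd_left _ _)).trans (hl h)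
    · exact (Int.natCast_dvd_natCast.2 (Nat.gcd_dvd_right _ _)).trans (hr h)

lemma dvd_m (T : VTree) {d : ℕ} (h : ∀ p ∈ T.leaves, (d : ℤ) ∣ p.2.1) : d ∣ T.m := by
  induction T with
  | leaf i c n => exact Int.natCast_dvd.1 (h _ (List.mem_singleton_self _))
  | node l r hl hr =>
    exact Nat.dvd_gcd (hl fun p hp => h p (List.mem_append_left _ hp))
      (hr fun p hp => h p (List.mem_append_right _ hp))

lemma m_dvd_c (T : VTree) : (T.m : ℤ) ∣ T.c := by
  induction T with
  | leaf i c n => simp [m, VTree.c]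
  | node l r hl hr =>
    exact dvd_add ((Int.natCast_dvd_natCast.2 (Nat.gcd_dvd_left _ _)).trans hl)
      ((Int.natCast_dvd_natCast.2 (Nat.gcd_dvd_right _ _)).trans hr)

lemma m_dvd_n (T : VTree) (hT : T.GoodLabels) : (T.m : ℤ) ∣ T.n := by
  induction T with
  | leaf i c n => simpa [m, VTree.n] using (hT (i, c, n) (List.mem_singleton_self _)).2.1
  | node l r hl hr =>
    exact dvd_add ((Int.natCast_dvd_natCast.2 (Nat.gcd_dvd_left _ _)).trans (hl hT.left))
      ((Int.natCast_dvd_natCast.2 (Nat.gcd_dvd_right _ _)).trans (hr hT.right))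

lemma m_left_dvd_zeta {l r : VTree} (hT : (node l r).GoodLabels) : (l.m : ℤ) ∣ zeta l r :=
  dvd_sub ((m_dvd_c l).mul_right _) ((m_dvd_n l hT.left).mul_right _)

lemma m_right_dvd_zeta {l r : VTree} (hT : (node l r).GoodLabels) : (r.m : ℤ) ∣ zeta l r :=
  dvd_sub ((m_dvd_n r hT.right).mul_left _) ((m_dvd_c r).mul_left _)

lemma leafProd_ne (T : VTree) (hT : T.GoodLabels) : T.leafProd ≠ 0 := by
  induction T with
  | leaf i c n =>
    have := (hT (i, c, n) (List.mem_singleton_self _)).1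
    exact qnum_ne (by simpa using this)
  | node l r hl hr => exact mul_ne_zero (hl hT.left) (hr hT.right)

/-- The product of all `[ζ_v]` divided by that of the leaf factors. -/
def zetaQuot (T : VTree) : K := T.zetaProd / T.leafProd

lemma zetaQuot_node (l r : VTree) :
    (node l r).zetaQuot = qnum (zeta l r) * (l.zetaQuot * r.zetaQuot) := by
  simp only [zetaQuot, zetaProd, leafProd]
  rw [mul_div_assoc, mul_div_mul_comm]

lemma m_cast_node (l r : VTree) : ((node l r).m : ℤ) = (Int.gcd l.m r.m : ℤ) := by
  simp [m, Int.gcd]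

lemma qnum_m_mul_zetaQuot_mem (T : VTree) (hT : T.GoodLabels) :
    qnum T.m * T.zetaQuot ∈ laurentRing := by
  induction T with
  | leaf i c n =>
    have h0 := leafProd_ne _ hT
    simp only [leafProd] at h0
    simp only [zetaQuot, zetaProd, leafProd, m]
    rw [mul_one_div_cancel h0]
    exact one_mem _
  | node l r hl hr =>
    specialize hl hT.left
    specialize hr hT.right
    rw [m_cast_node, zetaQuot_node]
    apply qnum_gcd_mul_mem
    · have := mul_mem hl (qnum_mul_mem_of_dvd (m_right_dvd_zeta hT) hr)
      convert this using 1; ring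
    · have := mul_mem hr (qnum_mul_mem_of_dvd (m_left_dvd_zeta hT) hl)
      convert this using 1; ring

/-- A common divisor `d` of both components of the root label that does not divide the leaf labels
is compensated by one more factor `[ζ_v]`. In terms of ideals: the multiplier `[m(T)]²` clears the
denominator `[d]` as well. -/
lemma qnum_m_sq_mul_zetaQuot_div_mem (T : VTree) (hT : T.GoodLabels) {d : ℤ} (hc : d ∣ T.c)
    (hn : d ∣ T.n) : qnum T.m ^ 2 * (T.zetaQuot / qnum d) ∈ laurentRing := by
  induction T generalizing d with
  | leaf i c n =>
    have h0 := leafProd_ne _ hT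
    simp only [leafProd] at h0
    have h1 : d ∣ (c.natAbs : ℤ) := Int.dvd_natAbs.2 hc
    have := qnum_div_mem h1
    simp only [zetaQuot, zetaProd, leafProd, m]
    convert this using 1
    field_simp
  | node l r hl hr =>
    have hA := qnum_m_mul_zetaQuot_mem l hT.left
    have hB := qnum_m_mul_zetaQuot_mem r hT.right
    have hdz : d ∣ zeta l r := by
      obtain ⟨u, hu⟩ := hc
      obtain ⟨v, hv⟩ := hn
      simp only [VTree.c, VTree.n] at hu hv
      refine ⟨u * r.n - v * r.c, ?_⟩
      rw [zeta]
      linear_combination r.n * hu - r.c * hv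
    have hz := qnum_div_mem hdz
    -- The symmetric statement for the two branches: `[m_l]²` times everything is integral.
    have key : ∀ l r : VTree, l.GoodLabels → r.GoodLabels →
        (∀ e : ℤ, e ∣ l.c → e ∣ l.n → qnum l.m ^ 2 * (l.zetaQuot / qnum e) ∈ laurentRing) →
        d ∣ l.c + r.c → d ∣ l.n + r.n → ∀ z : ℤ, d ∣ z → (r.m : ℤ) ∣ z →
        qnum l.m ^ 2 * (qnum z * (l.zetaQuot * r.zetaQuot) / qnum d) ∈ laurentRing := by
      intro l r gl gr ih hc hn z hdz hmz
      have hB := qnum_m_mul_zetaQuot_mem r gr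
      have hd1 : (Int.gcd d r.m : ℤ) ∣ d := Int.gcd_dvd_left _ _
      have hd2 : (Int.gcd d r.m : ℤ) ∣ r.m := Int.gcd_dvd_right _ _
      have h1 := ih (Int.gcd d r.m)
        ((dvd_add_left (hd2.trans (m_dvd_c r))).1 (hd1.trans hc))
        ((dvd_add_left (hd2.trans (m_dvd_n r gr))).1 (hd1.trans hn))
      have h2 : qnum (Int.gcd d r.m) * (qnum z * r.zetaQuot / qnum d) ∈ laurentRing := by
        rcases eq_or_ne (qnum d) 0 with h0 | h0
        · simp [h0, zero_mem]
        apply qnum_gcd_mul_mem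
        · convert qnum_mul_mem_of_dvd hmz hB using 1
          field_simp
        · convert mul_mem hB (qnum_div_mem hdz) using 1
          ring
      rcases eq_or_ne (qnum d) 0 with h0 | h0
      · simp [h0, zero_mem]
      have h3 : qnum (Int.gcd d r.m) ≠ 0 := by
        intro h
        obtain ⟨s, -, e⟩ := exists_qnum_eq_mul hd1
        rw [h, zero_mul] at e
        exact h0 e
      convert mul_mem h1 h2 using 1
      field_simp
    rw [m_cast_node, zetaQuot_node]
    apply qnum_gcd_sq_mul_mem
    · exact key l r hT.left hT.right (fun e => hl hT.left) hc hn _ hdz (m_right_dvd_zeta hT)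
    · convert mul_mem (mul_mem hA hB) hz using 1
      ring
    · have := key r l hT.right hT.left (fun e => hr hT.right) (by rw [add_comm]; exact hc)
        (by rw [add_comm]; exact hn) _ hdz (m_left_dvd_zeta hT)
      rwa [mul_comm r.zetaQuot] at this

lemma zeta_eq_zero {l r : VTree} (hc : (node l r).c = 0) (hn : (node l r).n = 0) :
    zeta l r = 0 := by
  simp only [VTree.c, VTree.n] at hc hn
  rw [zeta]
  linear_combination r.n * hc - r.c * hn

/-- A component with root label `(0, n)` has at most the pole `1 / t_{m(T)}`. -/
lemma qnum_m_sq_mul_ampB_mem (T : VTree) (hT : T.GoodLabels) (hc : T.c = 0) :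
    qnum T.m ^ 2 * T.ampB ∈ laurentRing := by
  by_cases hn : T.n = 0
  · cases T with
    | leaf i c n => exact absurd hc (hT (i, c, n) (List.mem_singleton_self _)).1
    | node l r =>
      have e : (node l r).ampB = (l.c : K) * (l.zetaQuot * r.zetaQuot) := by
        rw [ampB, ampA, if_pos hn, leafProd, zetaQuot, zetaQuot]
        rw [mul_div_assoc, mul_div_mul_comm]
      have hA := qnum_m_mul_zetaQuot_mem l hT.left
      have hB := qnum_m_mul_zetaQuot_mem r hT.right
      have key : ∀ l r : VTree, l.GoodLabels → r.GoodLabels → l.c + r.c = 0 → l.n + r.n = 0 →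
          qnum l.m ^ 2 * (l.zetaQuot * r.zetaQuot) ∈ laurentRing := by
        intro l r gl gr hc hn
        have h1 := qnum_m_sq_mul_zetaQuot_div_mem l gl (d := r.m)
          (by rw [eq_neg_of_add_eq_zero_left hc]; exact (m_dvd_c r).neg_right)
          (by rw [eq_neg_of_add_eq_zero_left hn]; exact (m_dvd_n r gr).neg_right)
        have h2 := qnum_m_mul_zetaQuot_mem r gr
        have hr0 : qnum r.m ≠ 0 := by
          apply qnum_ne
          cases hr : r.leaves with
          | nil => have := length_leaves r; rw [hr] at this; simp at this
          | cons p L =>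
            have hp : p ∈ r.leaves := by simp [hr]
            intro h0
            have := m_dvd_leaf r hp
            rw [h0, zero_dvd_iff] at this
            exact (gr p hp).1 this
        convert mul_mem h1 h2 using 1
        field_simp
      rw [e, mul_left_comm]
      refine mul_mem (intCast_mem _ _) ?_
      rw [m_cast_node]
      apply qnum_gcd_sq_mul_mem
      · exact key l r hT.left hT.right hc hn
      · convert mul_mem hA hB using 1
        ring
      · have := key r l hT.right hT.left (by rw [add_comm]; exact hc) (by rw [add_comm]; exact hn)
        rwa [mul_comm r.zetaQuot] at this
  · have e : T.ampB = T.zetaQuot / qnum T.n := by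
      cases T with
      | leaf i c n => rw [ampB, ampA, zetaQuot, div_right_comm]; rfl
      | node l r => rw [ampB, ampA, if_neg hn, zetaQuot, div_right_comm]
    rw [e]
    exact qnum_m_sq_mul_zetaQuot_div_mem T hT (by rw [hc]; exact dvd_zero _) dvd_rfl

/-! ### Parities -/

/-- Modulo `2` the `ζ_v` are differences of the quadratic form `c n`, so their sum telescopes. -/
lemma even_sum_zetas (T : VTree) (hT : T.GoodLabels) : Even (T.zetas.sum + T.n + T.c * T.n) := by
  induction T with
  | leaf i c n => simpa [zetas, VTree.n, VTree.c] using (hT (i, c, n) (List.mem_singleton_self _)).2.2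
  | node l r hl hr =>
    obtain ⟨u, hu⟩ := hl hT.left
    obtain ⟨v, hv⟩ := hr hT.right
    refine ⟨u + v + l.c * r.n, ?_⟩
    simp only [zetas, List.sum_cons, List.sum_append, VTree.n, VTree.c, zeta]
    linear_combination hu + hv

lemma even_sum_zetas_add_n (T : VTree) (hT : T.GoodLabels) (hc : T.c = 0) :
    Even (T.zetas.sum + T.n) := by
  simpa [hc] using even_sum_zetas T hT

lemma invHom_prod_qnum (L : List ℤ) :
    invHom (L.map qnum).prod = (-1) ^ L.length * (L.map qnum).prod := by
  induction L with
  | nil => simp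
  | cons a L ih =>
    simp only [List.map_cons, List.prod_cons, map_mul, ih, invHom_qnum, List.length_cons]
    ring

lemma negHom_prod_qnum (L : List ℤ) :
    negHom (L.map qnum).prod = (-1) ^ L.sum * (L.map qnum).prod := by
  induction L with
  | nil => simp
  | cons a L ih =>
    simp only [List.map_cons, List.prod_cons, map_mul, ih, negHom_qnum, List.sum_cons]
    rw [zpow_add₀ (by norm_num)]
    ring

lemma invHom_leafProd (T : VTree) :
    invHom T.leafProd = (-1) ^ (T.zetas.length + 1) * T.leafProd := by
  induction T with
  | leaf => simp [leafProd, zetas, invHom_qnum]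
  | node l r hl hr =>
    simp only [leafProd, map_mul, hl, hr, zetas, List.length_cons, List.length_append]
    ring

lemma neg_one_zpow_natAbs (a : ℤ) : (-1 : K) ^ (a.natAbs : ℤ) = (-1) ^ a := by
  rcases Int.even_or_odd a with h | h
  · rw [h.neg_one_zpow, Even.neg_one_zpow]; exact_mod_cast Int.natAbs_even.2 h
  · rw [h.neg_one_zpow, Odd.neg_one_zpow]; exact_mod_cast Int.natAbs_odd.2 h

lemma negHom_leafProd (T : VTree) : negHom T.leafProd = (-1) ^ T.c * T.leafProd := by
  induction T with
  | leaf => simp only [leafProd, negHom_qnum, neg_one_zpow_natAbs, VTree.c]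
  | node l r hl hr =>
    simp only [leafProd, map_mul, hl, hr, VTree.c]
    rw [zpow_add₀ (by norm_num)]
    ring

lemma c_scale (k : ℕ) (T : VTree) : (T.scale k).c = k * T.c := by
  induction T with
  | leaf => rfl
  | node l r hl hr => simp [scale, VTree.c, hl, hr, mul_add]

lemma n_scale (k : ℕ) (T : VTree) : (T.scale k).n = k * T.n := by
  induction T with
  | leaf => rfl
  | node l r hl hr => simp [scale, VTree.n, hl, hr, mul_add]

lemma zetas_scale (k : ℕ) (T : VTree) : (T.scale k).zetas = T.zetas.map fun a => (k : ℤ) ^ 2 * a := by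
  induction T with
  | leaf => rfl
  | node l r hl hr =>
    simp only [scale, zetas, hl, hr, zeta, c_scale, n_scale, List.map_cons, List.map_append]
    congr 1; ring

/-- The amplitude in terms of the list of the `ζ_v`. If `n_root = 0`, then `ζ_root = 0` is the head
of this list and only the tail `L` enters; the label `c` of `L(root)` is then the same for all
scalings of the tree, up to the factor `k`. -/
lemma ampA_eq (T : VTree) (hT : T.GoodLabels) (hc : T.c = 0) :
    (T.n ≠ 0 ∧ T.ampA = (T.zetas.map qnum).prod / qnum T.n) ∨
    (T.n = 0 ∧ ∃ (c : ℤ) (L : List ℤ), T.zetas = 0 :: L ∧ T.ampA = c * (L.map qnum).prod ∧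
      ∀ k : ℕ, 0 < k → (T.scale k).ampA = k * c * (L.map fun a => qnum (k ^ 2 * a)).prod) := by
  cases T with
  | leaf i c n => exact absurd hc (hT (i, c, n) (List.mem_singleton_self _)).1
  | node l r =>
    by_cases hn : (node l r).n = 0
    · right
      refine ⟨hn, l.c, l.zetas ++ r.zetas, by rw [zetas, zeta_eq_zero hc hn], ?_, ?_⟩
      · rw [ampA, if_pos hn, zetaProd_eq, zetaProd_eq]; simp
      · intro k hk
        have hn' : (node (l.scale k) (r.scale k)).n = 0 := by
          rw [← scale, n_scale, hn, mul_zero]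
        rw [scale, ampA, if_pos hn', zetaProd_eq, zetaProd_eq, c_scale, zetas_scale, zetas_scale]
        simp [Function.comp_def]
    · left
      exact ⟨hn, by rw [ampA, if_neg hn, zetaProd_eq]⟩

lemma invHom_ampB (T : VTree) (hT : T.GoodLabels) (hc : T.c = 0) : invHom T.ampB = T.ampB := by
  rw [ampB, map_div₀, invHom_leafProd]
  have h0 : T.leafProd ≠ 0 := leafProd_ne T hT
  rcases ampA_eq T hT hc with ⟨hn, e⟩ | ⟨hn, c, L, hz, e, -⟩
  · have hq := qnum_ne hn
    rw [e, map_div₀, invHom_prod_qnum, invHom_qnum, pow_succ]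
    rcases neg_one_pow_eq_or K T.zetas.length with h | h <;> rw [h] <;> field_simp
  · rw [e, map_mul, invHom_prod_qnum, hz, List.length_cons, map_intCast, pow_succ, pow_succ]
    rcases neg_one_pow_eq_or K L.length with h | h <;> rw [h] <;> field_simp

lemma negHom_ampB (T : VTree) (hT : T.GoodLabels) (hc : T.c = 0) : negHom T.ampB = T.ampB := by
  rw [ampB, map_div₀, negHom_leafProd, hc, zpow_zero, one_mul]
  have hev := even_sum_zetas_add_n T hT hc
  rcases ampA_eq T hT hc with ⟨hn, e⟩ | ⟨hn, c, L, hz, e, -⟩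
  · have hq := qnum_ne hn
    rw [e, map_div₀, negHom_prod_qnum, negHom_qnum]
    have : (-1 : K) ^ T.zetas.sum = (-1) ^ T.n := by
      have h := hev.neg_one_zpow (α := K)
      rw [zpow_add₀ (by norm_num)] at h
      rcases Int.even_or_odd T.n with h' | h' <;> rw [h'.neg_one_zpow] at h ⊢
      · simpa using h
      · linear_combination -h
    rw [this, mul_div_mul_left _ _ (zpow_ne_zero _ (by norm_num))]
  · rw [hz, hn] at hev
    rw [e, map_mul, negHom_prod_qnum, map_intCast, Even.neg_one_zpow (by simpa using hev), one_mul]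

/-! ### Scaling of the labels -/

lemma leafProd_scale {k : ℕ} (hk : 0 < k) (T : VTree) :
    (T.scale k).leafProd = powHom k hk T.leafProd := by
  induction T with
  | leaf i c n => simp [scale, leafProd, powHom_qnum, Int.natAbs_mul]
  | node l r hl hr => simp [scale, leafProd, hl, hr]

/-- The product of the `[k ζ_v] / [ζ_v]` over all vertices. -/
def qfacProd (k : ℕ) (T : VTree) : K := (T.zetas.map (qfac k)).prod

lemma prod_qnum_scale {k : ℕ} (hk : 0 < k) (L : List ℤ) :
    (L.map fun a => qnum (k ^ 2 * a)).prod =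
      powHom k hk ((L.map qnum).prod * (L.map (qfac k)).prod) := by
  induction L with
  | nil => simp
  | cons a L ih =>
    simp only [List.map_cons, List.prod_cons, ih]
    rw [pow_two, mul_assoc, ← powHom_qnum hk, qnum_mul_eq, ← map_mul]
    congr 1; ring

lemma ampB_scale {k : ℕ} (hk : 0 < k) (T : VTree) (hT : T.GoodLabels) (hc : T.c = 0) :
    (T.scale k).ampB = powHom k hk (T.ampB * T.qfacProd k) := by
  have hk0 : (k : ℤ) ≠ 0 := by exact_mod_cast hk.ne'
  rw [ampB, leafProd_scale hk, ampB, div_mul_eq_mul_div, map_div₀]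
  congr 1
  rcases ampA_eq T hT hc with ⟨hn, e⟩ | ⟨hn, c, L, hz, e, es⟩
  · have : (T.scale k).ampA = ((T.scale k).zetas.map qnum).prod / qnum (T.scale k).n := by
      cases T with
      | leaf i c n => exact absurd hc (hT (i, c, n) (List.mem_singleton_self _)).1
      | node l r =>
        have hn' : (node (l.scale k) (r.scale k)).n ≠ 0 := by
          rw [← scale, n_scale]; exact mul_ne_zero hk0 hn
        rw [scale, ampA, if_neg hn', zetaProd_eq]
    rw [this, e, zetas_scale, List.map_map, n_scale, ← powHom_qnum hk, div_mul_eq_mul_div, map_div₀,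
      qfacProd, ← prod_qnum_scale hk]
    rfl
  · rw [es k hk, prod_qnum_scale hk, e, qfacProd, hz, List.map_cons, List.prod_cons,
      qfac_zero_right]
    simp only [map_mul, map_natCast, map_intCast]
    ring

lemma invHom_qfacProd (k : ℕ) (T : VTree) : invHom (T.qfacProd k) = T.qfacProd k := by
  rw [qfacProd, map_list_prod, List.map_map]
  congr 2
  funext a
  exact invHom_qfac k a

lemma negHom_qfacProd_of_odd {k : ℕ} (hk : Odd k) (T : VTree) :
    negHom (T.qfacProd k) = T.qfacProd k := by
  rw [qfacProd, map_list_prod, List.map_map]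
  congr 2
  funext a
  exact negHom_qfac_of_odd hk a

/-- The correction factor of a tree of type I for even `k`, before the substitution `q → q^k`. -/
def typeFactor (k : ℕ) (T : VTree) : K :=
  if Even k ∧ Odd T.m ∧ Odd T.n then (x ^ (T.m : ℤ) + x ^ (-(T.m : ℤ))) / 2 else 1

lemma congT_qfacProd {k : ℕ} (T : VTree) (hT : T.GoodLabels) (hc : T.c = 0) :
    CongT (T.qfacProd k) ((k : K) ^ T.zetas.length * T.typeFactor k) := by
  have hne : T.zetas ≠ [] := by
    cases T with
    | leaf i c n => exact absurd hc (hT (i, c, n) (List.mem_singleton_self _)).1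
    | node l r => simp [zetas]
  have hpar := even_sum_zetas_add_n T hT hc
  rcases Nat.even_or_odd' k with ⟨b, hb | hb⟩
  · have hk : Even k := ⟨b, by omega⟩
    subst hb
    have h1 := congT_qfac_even_prod b T.zetas hne
    obtain ⟨j, hj⟩ : ∃ j, T.zetas.length = j + 1 :=
      ⟨T.zetas.length - 1, by have := List.length_pos_iff.2 hne; omega⟩
    refine CongT.trans (v := _) h1 ?_
    rw [hj, Nat.add_sub_cancel]
    have hmem : (b : K) ^ (j + 1) * 2 ^ j ∈ laurentRing :=
      mul_mem (pow_mem (natCast_mem _ b) _) (pow_mem (natCast_mem _ 2) _)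
    by_cases hn : Odd T.n
    · have hm : Odd T.m := by
        obtain ⟨u, hu⟩ := m_dvd_n T hT
        rw [hu, Int.odd_mul] at hn
        exact_mod_cast hn.1
      have hs : ¬ Even T.zetas.sum := by
        intro h
        rw [Int.even_add, iff_true_left h] at hpar
        exact Int.not_even_iff_odd.2 hn hpar
      have h2 := congT_zpow_add_zpow_neg (T.m : ℤ)
      have e : parityResidue T.zetas.sum = parityResidue (T.m : ℤ) := by
        have : ¬ Even (T.m : ℤ) := by
          rw [Int.not_even_iff_odd]; exact_mod_cast hm
        rw [parityResidue, parityResidue, if_neg hs, if_neg this]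
      rw [typeFactor, if_pos ⟨hk, hm, hn⟩, e]
      have h3 := (CongT.refl hmem).mul h2.symm
      convert h3 using 1
      push_cast
      ring
    · rw [typeFactor, if_neg (by tauto)]
      have hs : Even T.zetas.sum := by
        rw [Int.even_add] at hpar
        exact hpar.2 (Int.not_odd_iff_even.1 hn)
      rw [parityResidue, if_pos hs]
      have e : (b : K) ^ (j + 1) * 2 ^ j * 2 = ((2 * b : ℕ) : K) ^ (j + 1) * 1 := by
        push_cast; ring
      rw [e, ← e]
      exact CongT.refl (mul_mem hmem (natCast_mem _ 2))
  · have hk : Odd k := ⟨b, hb⟩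
    rw [typeFactor, if_neg (fun h => Nat.not_even_iff_odd.2 hk h.1), mul_one]
    have := CongT.list_prod T.zetas (f := qfac k) (g := fun _ => (k : K))
      (fun a _ => congT_qfac_odd hk a)
    simpa [qfacProd] using this

lemma invHom_typeFactor (k : ℕ) (T : VTree) : invHom (T.typeFactor k) = T.typeFactor k := by
  unfold typeFactor
  split_ifs
  · rw [map_div₀, map_add, invHom_x_zpow, invHom_x_zpow, neg_neg, add_comm, map_ofNat]
  · exact map_one _

lemma typeFactor_of_odd {k : ℕ} (hk : Odd k) (T : VTree) : T.typeFactor k = 1 :=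
  if_neg fun h => Nat.not_even_iff_odd.2 hk h.1

lemma typeFactor_of_even {k : ℕ} (hk : Even k) (T : VTree) : T.typeFactor k = T.typeFactor 2 := by
  simp [typeFactor, hk]

lemma powHom_typeFactor {k j : ℕ} (hk : 0 < k) (hj : Even j) (hke : Even k) (T : VTree) :
    powHom k hk (T.typeFactor j) =
      if Odd T.m ∧ Odd T.n then 1 + tk (T.m * k / 2) / 2 else 1 := by
  obtain ⟨b, rfl⟩ := hke
  have hb : T.m * (b + b) / 2 = T.m * b := by
    rw [← two_mul, mul_left_comm, Nat.mul_div_cancel_left _ two_pos]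
  rw [typeFactor, hb]
  simp only [hj, true_and]
  split_ifs
  · rw [map_div₀, map_add, powHom_x_zpow, powHom_x_zpow, map_ofNat]
    have h := zpow_add_zpow_neg (T.m * b : ℕ)
    rw [show (((b + b : ℕ) : ℤ) * (T.m : ℤ)) = 2 * ((T.m * b : ℕ) : ℤ) by push_cast; ring,
      show (((b + b : ℕ) : ℤ) * -(T.m : ℤ)) = -(2 * ((T.m * b : ℕ) : ℤ)) by push_cast; ring, h]
    simp only [tk]
    ring
  · exact map_one _

end VTree

/-! ### Leaves and roots of the generated forests -/

namespace VTree

lemma mem_subtrees_self (T : VTree) : T ∈ T.subtrees := by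
  cases T <;> simp [subtrees]

lemma leaf_mem_subtrees {T : VTree} {p : ℕ × ℤ × ℤ} (hp : p ∈ T.leaves) :
    leaf p.1 p.2.1 p.2.2 ∈ T.subtrees := by
  induction T with
  | leaf i c n => simp only [leaves, List.mem_singleton] at hp; subst hp; simp [subtrees]
  | node l r hl hr =>
    rcases List.mem_append.1 hp with h | h
    · simp [subtrees, hl h]
    · simp [subtrees, hr h]

lemma leaves_subset_of_mem_subtrees {u T : VTree} (hu : u ∈ T.subtrees) :
    u.leaves ⊆ T.leaves := by
  induction T with
  | leaf i c n => simp only [subtrees, List.mem_singleton] at hu; subst hu; exact fun _ h => h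
  | node l r hl hr =>
    simp only [subtrees, List.mem_cons, List.mem_append] at hu
    rcases hu with rfl | h | h
    · exact fun _ h => h
    · exact fun p hp => List.mem_append_left _ (hl h hp)
    · exact fun p hp => List.mem_append_right _ (hr h hp)

lemma exists_isUpper {u T : VTree} (hu : u ∈ T.subtrees) (hne : u ≠ T) :
    ∃ v ∈ T.subtrees, u.IsUpper v := by
  induction T with
  | leaf i c n => simp only [subtrees, List.mem_singleton] at hu; exact absurd hu hne
  | node l r hl hr =>
    simp only [subtrees, List.mem_cons, List.mem_append] at hu
    rcases hu with rfl | h | h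
    · exact absurd rfl hne
    · by_cases e : u = l
      · exact ⟨node l r, by simp [subtrees], r, Or.inl (by rw [e])⟩
      · obtain ⟨v, hv, huv⟩ := hl h e
        exact ⟨v, by simp [subtrees, hv], huv⟩
    · by_cases e : u = r
      · exact ⟨node l r, by simp [subtrees], l, Or.inr (by rw [e])⟩
      · obtain ⟨v, hv, huv⟩ := hr h e
        exact ⟨v, by simp [subtrees, hv], huv⟩

lemma IsUpper.length_zetas_lt {u v : VTree} (h : u.IsUpper v) :
    u.zetas.length < v.zetas.length := by
  obtain ⟨w, rfl | rfl⟩ := h <;> simp [zetas]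

lemma leaves_ne_nil (T : VTree) : T.leaves ≠ [] := by
  intro h
  have := length_leaves T
  simp [h] at this

lemma IsUpper.leaves_subset {u v : VTree} (h : u.IsUpper v) : u.leaves ⊆ v.leaves := by
  obtain ⟨w, rfl | rfl⟩ := h <;> simp [leaves]

lemma n_eq_sum_leaves (T : VTree) : T.n = (T.leaves.map fun p => p.2.2).sum := by
  induction T with
  | leaf => simp [VTree.n, leaves]
  | node l r hl hr => simp [VTree.n, leaves, hl, hr]

/-- The leaf indices of a tree. -/
def idxs (T : VTree) : List ℕ := T.leaves.map Prod.fst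

end VTree

lemma Generates.leaves_perm {L F : List VTree} (h : Generates L F) :
    (F.flatMap VTree.leaves).Perm (L.flatMap VTree.leaves) := by
  induction h with
  | nil => rfl
  | strip L T F hT h ih =>
    simp only [List.flatMap_cons, List.flatMap_append, List.flatMap_nil, List.append_nil]
    exact (ih.append_left _).trans List.perm_append_comm
  | swap L T S R F hT hS hR h ih =>
    refine ih.trans ?_
    exact List.Perm.flatMap_right _ ((List.Perm.swap T S R).append_left L)
  | merge L T S R F hT hS hR hne h ih =>
    refine ih.trans ?_
    simp [VTree.leaves]
  | white L T S R F hT hS hR heq h ih =>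
    simp only [List.flatMap_cons, List.flatMap_append, VTree.leaves] at ih ⊢
    refine (ih.append_left _).trans ?_
    rw [← List.append_assoc, ← List.append_assoc T.leaves, ← List.append_assoc (L.flatMap _)]
    exact List.perm_append_comm.append_right _

lemma Generates.c_eq_zero {L F : List VTree} (h : Generates L F) : ∀ T ∈ F, T.c = 0 := by
  induction h with
  | nil => simp
  | strip L T F hT h ih => simpa [hT] using ih
  | swap L T S R F hT hS hR h ih => exact ih
  | merge L T S R F hT hS hR hne h ih => exact ih
  | white L T S R F hT hS hR heq h ih => simpa [VTree.c, heq.1] using ih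

lemma graphs_leaves_perm {cn : List (ℤ × ℤ)} {F : List VTree} (h : F ∈ graphs cn) :
    (F.flatMap VTree.leaves).Perm (cn.mapIdx fun i p => (i, p)) := by
  refine (Generates.leaves_perm h).trans (List.Perm.of_eq ?_)
  rw [List.mapIdx_eq_zipIdx_map, List.mapIdx_eq_zipIdx_map, List.flatMap_map]
  simp only [VTree.leaves]
  rw [← List.map_eq_flatMap]

/-! ### Positions in the union of two partitions -/

lemma exists_getElem?_of_lt_countP {p : ℕ → Bool} (hp : ∀ a b, b ≤ a → p b → p a) {U : List ℕ}
    (hU : U.Pairwise (· ≥ ·)) {i : ℕ} (hi : i < U.countP p) : ∃ a, U[i]? = some a ∧ p a := by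
  induction U generalizing i with
  | nil => simp at hi
  | cons a U ih =>
    rw [List.pairwise_cons] at hU
    by_cases ha : p a
    · cases i with
      | zero => exact ⟨a, by simp, ha⟩
      | succ i =>
        rw [List.countP_cons_of_pos ha] at hi
        simpa using ih hU.2 (by omega)
    · rw [List.countP_cons_of_neg ha] at hi
      have : U.countP p = 0 := List.countP_eq_zero.2 fun b hb h => ha (hp _ _ (hU.1 b hb) h)
      omega

lemma not_of_countP_le {p : ℕ → Bool} (hp : ∀ a b, b ≤ a → p b → p a) {U : List ℕ}
    (hU : U.Pairwise (· ≥ ·)) {i a : ℕ} (hi : U.countP p ≤ i) (ha : U[i]? = some a) : ¬ p a := by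
  induction U generalizing i with
  | nil => simp at ha
  | cons b U ih =>
    rw [List.pairwise_cons] at hU
    cases i with
    | zero =>
      simp only [List.getElem?_cons_zero, Option.some.injEq] at ha
      subst ha
      exact List.countP_eq_zero.1 (Nat.le_zero.1 hi) b (by simp)
    | succ i =>
      simp only [List.getElem?_cons_succ] at ha
      by_cases hb : p b
      · rw [List.countP_cons_of_pos hb] at hi
        exact ih hU.2 (by omega) ha
      · exact fun h => hb (hp _ _ (hU.1 a (List.mem_of_getElem? ha)) h)

lemma ptnUnion_perm (p p' : List ℕ) : (ptnUnion p p').Perm (p ++ p') :=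
  List.perm_insertionSort _ _

lemma length_ptnUnion (p p' : List ℕ) : (ptnUnion p p').length = p.length + p'.length := by
  rw [(ptnUnion_perm p p').length_eq, List.length_append]

/-- The `j`-th part `a` of `q` stands in `p ∪ q` after `j` parts of `q` and after the parts of `p`
that are at least `a`. -/
lemma ptnUnion_getElem? {p q : List ℕ} (hq : q.Pairwise (· ≥ ·)) {j a : ℕ} (ha : q[j]? = some a) :
    (ptnUnion p q)[j + p.countP fun b => decide (a ≤ b)]? = some a := by
  have hU : (ptnUnion p q).Pairwise (· ≥ ·) := List.pairwise_insertionSort _ _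
  have m1 : ∀ c b : ℕ, b ≤ c → decide (a ≤ b) = true → decide (a ≤ c) = true := by
    intro c b h h'; simp only [decide_eq_true_eq] at *; omega
  have m2 : ∀ c b : ℕ, b ≤ c → decide (a < b) = true → decide (a < c) = true := by
    intro c b h h'; simp only [decide_eq_true_eq] at *; omega
  have h1 : j < q.countP fun b => decide (a ≤ b) := by
    by_contra h
    exact not_of_countP_le m1 hq (not_lt.1 h) ha (by simp)
  have h2 : (q.countP fun b => decide (a < b)) ≤ j := by
    by_contra h
    obtain ⟨a', ha', h'⟩ := exists_getElem?_of_lt_countP m2 hq (not_le.1 h)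
    rw [ha] at ha'
    simp at ha' h'
    omega
  have h3 : (p.countP fun b => decide (a < b)) ≤ p.countP fun b => decide (a ≤ b) :=
    List.countP_mono_left fun b _ h => by simp only [decide_eq_true_eq] at *; omega
  obtain ⟨u, hu, hau⟩ := exists_getElem?_of_lt_countP m1 hU
    (i := j + p.countP fun b => decide (a ≤ b))
    (by rw [(ptnUnion_perm p q).countP_eq, List.countP_append]; omega)
  have h4 := not_of_countP_le m2 hU
    (by rw [(ptnUnion_perm p q).countP_eq, List.countP_append]; omega) hu
  simp only [decide_eq_true_eq] at hau h4
  rw [hu]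
  congr 1
  omega

/-! ### The trees of a combined forest -/

namespace CombForest

variable {r : ℕ}

/-- The index set of the VEV trees in `W`. -/
abbrev TreeIdx (W : CombForest r) : Type := (i : Fin r) × Fin (W.forest i).length

/-- The tree with a given index. -/
def tree (W : CombForest r) (τ : W.TreeIdx) : VTree := (W.forest τ.1)[τ.2]

lemma tree_mem (W : CombForest r) (τ : W.TreeIdx) : W.tree τ ∈ W.forest τ.1 :=
  List.getElem_mem _

lemma exists_tree {W : CombForest r} {i : Fin r} {T : VTree} (hT : T ∈ W.forest i) :
    ∃ τ : W.TreeIdx, τ.1 = i ∧ W.tree τ = T := by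
  obtain ⟨j, hj, e⟩ := List.getElem_of_mem hT
  exact ⟨⟨i, ⟨j, hj⟩⟩, rfl, e⟩

@[to_additive]
lemma prod_forest_eq_prod_tree {M : Type*} [CommMonoid M] (W : CombForest r) (f : VTree → M) :
    ∏ i, ((W.forest i).map f).prod = ∏ τ, f (W.tree τ) := by
  rw [Fintype.prod_sigma]
  refine Finset.prod_congr rfl fun i _ => ?_
  rw [← Fin.prod_univ_fun_getElem]
  rfl

lemma lam_getElem? {W : CombForest r} (b : W.Bridge) :
    (W.rset.lam b.1)[(b.2 : ℕ)]? = some (W.h b) := by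
  simp [h]

lemma leftIdx_lt {W : CombForest r} (b : W.Bridge) :
    W.leftIdx b < (W.rset.mu b.1).length + (W.rset.lam b.1).length := by
  have := b.2.2
  rw [leftIdx]
  omega

lemma exists_owner {W : CombForest r} (v : W.Vertex) :
    ∃ τ : W.TreeIdx, τ.1 = v.1.1 ∧ v.1.2 ∈ (W.tree τ).subtrees := by
  obtain ⟨T, hT, hv⟩ := v.2
  obtain ⟨τ, h1, rfl⟩ := exists_tree hT
  exact ⟨τ, h1, hv⟩

variable [NeZero r]

/-- The labels `(c, n)` of the initial row for the forest `F_i`. -/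
def rowLabels (γ : Fin r → ℤ) (W : CombForest r) (i : Fin r) : List (ℤ × ℤ) :=
  (ptnUnion (W.rset.mu i) (W.rset.lam i)).reverse.map (fun x : ℕ => ((x : ℤ), (0 : ℤ))) ++
    (ptnUnion (W.rset.nu i) (W.rset.lam (i + 1))).map (fun x : ℕ => (-(x : ℤ), (γ i + 2) * (x : ℤ)))

variable {γ : Fin r → ℤ} {W : CombForest r}

lemma forest_mem_graphs (hW : W ∈ comb γ W.rset) (i : Fin r) :
    W.forest i ∈ graphs (W.rowLabels γ i) := by
  -- In `graphsOfPartitions` the lists of parts are coerced to `List ℤ` by a monadic bind.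
  have e : ∀ L : List ℕ, (L >>= fun a : ℕ => pure (a : ℤ)) = L.map fun a : ℕ => (a : ℤ) := by
    intro L
    induction L with
    | nil => rfl
    | cons a L ih => rw [List.map_cons, ← ih]; rfl
  have h := hW.2 i
  unfold graphsOfPartitions at h
  rw [e, e, List.map_map, List.map_map] at h
  exact h

lemma forest_leaves_perm (hW : W ∈ comb γ W.rset) (i : Fin r) :
    ((W.forest i).flatMap VTree.leaves).Perm ((W.rowLabels γ i).mapIdx fun j p => (j, p)) :=
  graphs_leaves_perm (forest_mem_graphs hW i)

lemma tree_c (hW : W ∈ comb γ W.rset) (τ : W.TreeIdx) : (W.tree τ).c = 0 :=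
  Generates.c_eq_zero (forest_mem_graphs hW τ.1) _ (W.tree_mem τ)

lemma getElem?_of_mem_leaves (hW : W ∈ comb γ W.rset) {τ : W.TreeIdx} {p : ℕ × ℤ × ℤ}
    (hp : p ∈ (W.tree τ).leaves) : (W.rowLabels γ τ.1)[p.1]? = some p.2 := by
  have h1 : p ∈ (W.forest τ.1).flatMap VTree.leaves :=
    List.mem_flatMap.2 ⟨_, W.tree_mem τ, hp⟩
  rw [(forest_leaves_perm hW τ.1).mem_iff, List.mem_mapIdx] at h1
  obtain ⟨j, hj, rfl⟩ := h1
  exact List.getElem?_eq_getElem hj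

lemma exists_mem_leaves (hW : W ∈ comb γ W.rset) {i : Fin r} {j : ℕ} {p : ℤ × ℤ}
    (hp : (W.rowLabels γ i)[j]? = some p) :
    ∃ τ : W.TreeIdx, τ.1 = i ∧ (j, p) ∈ (W.tree τ).leaves := by
  have h1 : (j, p) ∈ (W.forest i).flatMap VTree.leaves := by
    rw [(forest_leaves_perm hW i).mem_iff, List.mem_mapIdx]
    obtain ⟨hj, e⟩ := List.getElem?_eq_some_iff.1 hp
    exact ⟨j, hj, by rw [e]⟩
  obtain ⟨T, hT, hpT⟩ := List.mem_flatMap.1 h1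
  obtain ⟨τ, rfl, rfl⟩ := exists_tree hT
  exact ⟨τ, rfl, hpT⟩

lemma tree_goodLabels (hS : W.rset.IsRSet) (hW : W ∈ comb γ W.rset) (τ : W.TreeIdx) :
    (W.tree τ).GoodLabels := by
  intro p hp
  have h := List.mem_of_getElem? (getElem?_of_mem_leaves hW hp)
  have pos : ∀ a b : List ℕ, IsPartition a → IsPartition b → ∀ x ∈ ptnUnion a b, 0 < x := by
    intro a b ha hb x hx
    rw [(ptnUnion_perm a b).mem_iff, List.mem_append] at hx
    exact hx.elim (ha.2 x) (hb.2 x)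
  rw [rowLabels, List.mem_append, List.mem_map, List.mem_map] at h
  rcases h with ⟨y, hy, e⟩ | ⟨y, hy, e⟩
  · have := pos _ _ (hS.1 τ.1).1 (hS.1 τ.1).2.2 y (by simpa using hy)
    rw [← e]
    exact ⟨by simpa using this.ne', by simp, by simp⟩
  · have := pos _ _ (hS.1 τ.1).2.1 (hS.1 (τ.1 + 1)).2.2 y hy
    rw [← e]
    refine ⟨by simpa using this.ne', ⟨-(γ τ.1 + 2), by ring⟩, ?_⟩
    have h2 : (γ τ.1 + 2) * (y : ℤ) + -(y : ℤ) * ((γ τ.1 + 2) * y) =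
      -((γ τ.1 + 2) * (y * (y - 1))) := by ring
    rw [h2]
    exact ((Int.even_mul_pred_self y).mul_left _).neg

/-- Different trees of `F_i` have no leaf index in common. -/
lemma tree_idx_unique (hW : W ∈ comb γ W.rset) {τ τ' : W.TreeIdx} (h : τ.1 = τ'.1) {j : ℕ}
    (hj : j ∈ (W.tree τ).idxs) (hj' : j ∈ (W.tree τ').idxs) : τ = τ' := by
  obtain ⟨i, a⟩ := τ
  obtain ⟨i', a'⟩ := τ'
  obtain rfl : i = i' := h
  have hnd : ((W.forest i).flatMap VTree.idxs).Nodup := by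
    have h1 := (forest_leaves_perm hW i).map Prod.fst
    rw [List.map_flatMap] at h1
    refine (List.Perm.nodup_iff h1).2 ?_
    rw [List.nodup_iff_injective_getElem]
    intro x y hxy
    simpa [Fin.ext_iff] using hxy
  have hpw := List.pairwise_iff_get.1 (List.nodup_flatMap.1 hnd).2
  rcases lt_trichotomy a a' with hlt | rfl | hlt
  · exact (hpw a a' hlt hj hj').elim
  · rfl
  · exact (hpw a' a hlt hj' hj).elim

lemma sum_n (hS : W.rset.IsRSet) (hW : W ∈ comb γ W.rset) :
    ∑ τ, (W.tree τ).n = ∑ i, (γ i + 2) * (W.rset.degree i : ℤ) := by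
  rw [← sum_forest_eq_sum_tree]
  refine Finset.sum_congr rfl fun i _ => ?_
  have h1 := ((forest_leaves_perm hW i).map fun p => p.2.2).sum_eq
  have h2 : ∀ F : List VTree, (F.map VTree.n).sum =
      ((F.flatMap VTree.leaves).map fun p => p.2.2).sum := by
    intro F
    induction F with
    | nil => rfl
    | cons T F ih => simp [ih, VTree.n_eq_sum_leaves]
  have h3 : ∀ L : List (ℤ × ℤ), ((L.mapIdx fun j p => (j, p)).map fun p => p.2.2) =
      L.map Prod.snd := by
    intro L
    apply List.ext_getElem <;> simp
  have h4 : ∀ (a : ℤ) (L : List ℕ), (L.map fun x : ℕ => a * (x : ℤ)).sum = a * (L.sum : ℤ) := by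
    intro a L
    induction L with
    | nil => simp
    | cons x L ih => simp [ih, mul_add]
  rw [h2, h1, h3, rowLabels, List.map_append, List.sum_append, List.map_map, List.map_map]
  simp only [Function.comp_def]
  rw [h4, (ptnUnion_perm _ _).sum_eq, List.sum_append, ← hS.2 i, Triple.degree]
  simp

/-- Counting leaves: each part of `λ` is the label of two leaves, each part of `μ` or `ν` of one. -/
lemma sum_length_leaves (hW : W ∈ comb γ W.rset) :
    ∑ τ, (W.tree τ).leaves.length = W.rset.lenMu + W.rset.lenNu + 2 * W.rset.lenLam := by
  rw [← sum_forest_eq_sum_tree W fun T => T.leaves.length]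
  have h1 : ∀ i, ((W.forest i).map fun T => T.leaves.length).sum =
      (W.rset.mu i).length + (W.rset.lam i).length +
        ((W.rset.nu i).length + (W.rset.lam (i + 1)).length) := by
    intro i
    rw [← List.length_flatMap, (forest_leaves_perm hW i).length_eq]
    simp [rowLabels, length_ptnUnion]
  simp only [h1, Finset.sum_add_distrib, Triple.lenMu, Triple.lenNu, Triple.lenLam]
  have h2 : ∑ i, (W.rset.lam (i + 1)).length = ∑ i, (W.rset.lam i).length :=
    Equiv.sum_comp (Equiv.addRight (1 : Fin r)) fun i => (W.rset.lam i).length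
  rw [h2]
  ring

/-! ### Bridges -/

lemma rowLabels_leftIdx (hS : W.rset.IsRSet) (b : W.Bridge) :
    (W.rowLabels γ b.1)[W.leftIdx b]? = some ((W.h b : ℤ), 0) := by
  have h1 := ptnUnion_getElem? (p := W.rset.mu b.1) (hS.1 b.1).2.2.1 (lam_getElem? b)
  obtain ⟨hlt, -⟩ := List.getElem?_eq_some_iff.1 h1
  have hlen := length_ptnUnion (W.rset.mu b.1) (W.rset.lam b.1)
  rw [hlen] at hlt
  rw [rowLabels, leftIdx, List.getElem?_append_left (by simp [hlen]; omega), List.getElem?_map,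
    List.getElem?_reverse (by rw [hlen]; omega), hlen, Nat.sub_sub_self (by omega), h1]
  rfl

lemma rowLabels_rightIdx (hS : W.rset.IsRSet) (b : W.Bridge) :
    ∃ n, (W.rowLabels γ (b.1 - 1))[W.rightIdx b]? = some (-(W.h b : ℤ), n) := by
  have h1 := ptnUnion_getElem? (p := W.rset.nu (b.1 - 1)) (hS.1 b.1).2.2.1 (lam_getElem? b)
  have hlen := length_ptnUnion (W.rset.mu (b.1 - 1)) (W.rset.lam (b.1 - 1))
  refine ⟨(γ (b.1 - 1) + 2) * (W.h b : ℤ), ?_⟩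
  rw [rowLabels, rightIdx, List.getElem?_append_right (by simp [hlen]), List.getElem?_map,
    sub_add_cancel]
  rw [List.length_map, List.length_reverse, hlen, Nat.add_sub_cancel_left]
  rw [h1]
  rfl

lemma leftIdx_injective (hS : W.rset.IsRSet) {b b' : W.Bridge} (h1 : b.1 = b'.1)
    (h2 : W.leftIdx b = W.leftIdx b') : b = b' := by
  obtain ⟨i, j⟩ := b
  obtain ⟨i', j'⟩ := b'
  obtain rfl : i = i' := h1
  have key : ∀ j j' : Fin (W.rset.lam i).length, j < j' → W.leftIdx ⟨i, j'⟩ < W.leftIdx ⟨i, j⟩ := by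
    intro j j' hlt
    have hh : W.h ⟨i, j'⟩ ≤ W.h ⟨i, j⟩ := List.pairwise_iff_get.1 (hS.1 i).2.2.1 j j' hlt
    have hc : ((W.rset.mu i).countP fun x => decide (W.h ⟨i, j⟩ ≤ x)) ≤
        (W.rset.mu i).countP fun x => decide (W.h ⟨i, j'⟩ ≤ x) :=
      List.countP_mono_left fun x _ hx => by simp only [decide_eq_true_eq] at *; omega
    have hc' := List.countP_le_length (l := W.rset.mu i) (p := fun x => decide (W.h ⟨i, j'⟩ ≤ x))
    have := j'.2
    have : (j : ℕ) < j' := hlt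
    simp only [leftIdx]
    omega
  rcases lt_trichotomy j j' with hlt | rfl | hlt
  · exact absurd h2 (key j j' hlt).ne'
  · rfl
  · exact absurd h2 (key j' j hlt).ne

/-- The left leaf of the bridge `b` lies in the tree `τ`. -/
def LeftEnd (W : CombForest r) (b : W.Bridge) (τ : W.TreeIdx) : Prop :=
  τ.1 = b.1 ∧ W.leftIdx b ∈ (W.tree τ).idxs

/-- The right leaf of the bridge `b` lies in the tree `τ`. -/
def RightEnd (W : CombForest r) (b : W.Bridge) (τ : W.TreeIdx) : Prop :=
  τ.1 = b.1 - 1 ∧ W.rightIdx b ∈ (W.tree τ).idxs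

lemma LeftEnd.m_dvd_h (hS : W.rset.IsRSet) (hW : W ∈ comb γ W.rset) {b : W.Bridge} {τ : W.TreeIdx}
    (h : W.LeftEnd b τ) : (W.tree τ).m ∣ W.h b := by
  obtain ⟨h1, h2⟩ := h
  obtain ⟨p, hp, e⟩ := List.mem_map.1 h2
  have h3 := getElem?_of_mem_leaves hW hp
  rw [h1, e, rowLabels_leftIdx hS, Option.some.injEq] at h3
  have h4 := VTree.m_dvd_leaf _ hp
  rw [← h3] at h4
  exact Int.natCast_dvd_natCast.1 h4

lemma RightEnd.m_dvd_h (hS : W.rset.IsRSet) (hW : W ∈ comb γ W.rset) {b : W.Bridge} {τ : W.TreeIdx}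
    (h : W.RightEnd b τ) : (W.tree τ).m ∣ W.h b := by
  obtain ⟨h1, h2⟩ := h
  obtain ⟨p, hp, e⟩ := List.mem_map.1 h2
  have h3 := getElem?_of_mem_leaves hW hp
  obtain ⟨n, hn⟩ := rowLabels_rightIdx (γ := γ) hS b
  rw [h1, e, hn, Option.some.injEq] at h3
  have h4 := VTree.m_dvd_leaf _ hp
  rw [← h3] at h4
  exact Int.natCast_dvd_natCast.1 ((dvd_neg).1 h4)

/-- The graph with the trees of `W` as vertices, two trees being adjacent if they are joined by a
bridge. -/
def treeGraph (W : CombForest r) : SimpleGraph W.TreeIdx :=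
  SimpleGraph.fromRel fun τ τ' => ∃ b, W.LeftEnd b τ ∧ W.RightEnd b τ'

lemma idxs_subset_of_mem_subtrees {u T : VTree} (hu : u ∈ T.subtrees) : u.idxs ⊆ T.idxs :=
  List.map_subset _ (VTree.leaves_subset_of_mem_subtrees hu)

lemma exists_mem_idxs (T : VTree) : ∃ j, j ∈ T.idxs := by
  obtain ⟨p, hp⟩ := List.exists_mem_of_ne_nil _ (VTree.leaves_ne_nil T)
  exact ⟨p.1, List.mem_map_of_mem hp⟩

lemma treeGraph_connected (hW : W ∈ comb γ W.rset) (hc : W.graph.Connected) :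
    W.treeGraph.Connected := by
  choose own h1 h2 using exists_owner (W := W)
  have hadj : ∀ u v : W.Vertex, W.graph.Adj u v → W.treeGraph.Reachable (own u) (own v) := by
    have key : ∀ u v : W.Vertex, ((u.1.1 = v.1.1 ∧ u.1.2.IsUpper v.1.2) ∨
        ∃ b, W.BridgeJoins b u v) → W.treeGraph.Reachable (own u) (own v) := by
      rintro u v (⟨e, hu⟩ | ⟨b, ⟨c, n, e1⟩, ⟨c', n', e2⟩⟩)
      · have : own u = own v := by
          obtain ⟨j, hj⟩ := exists_mem_idxs u.1.2
          refine tree_idx_unique hW (by rw [h1, h1, e])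
            (idxs_subset_of_mem_subtrees (h2 u) hj)
            (idxs_subset_of_mem_subtrees (h2 v) (List.map_subset _ hu.leaves_subset hj))
        rw [this]
      · by_cases e : own u = own v
        · rw [e]
        · refine SimpleGraph.Adj.reachable ?_
          rw [treeGraph, SimpleGraph.fromRel_adj]
          refine ⟨e, Or.inl ⟨b, ⟨?_, ?_⟩, ⟨?_, ?_⟩⟩⟩
          · rw [h1, e1]
          · apply idxs_subset_of_mem_subtrees (h2 u)
            rw [e1]; simp [VTree.idxs, VTree.leaves]
          · rw [h1, e2]
          · apply idxs_subset_of_mem_subtrees (h2 v)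
            rw [e2]; simp [VTree.idxs, VTree.leaves]
    intro u v huv
    rw [graph, SimpleGraph.fromRel_adj] at huv
    rcases huv.2 with h | h
    · exact key u v h
    · exact (key v u h).symm
  have hreach : ∀ u v : W.Vertex, W.treeGraph.Reachable (own u) (own v) := by
    intro u v
    obtain ⟨p⟩ := hc.preconnected u v
    induction p with
    | nil => rfl
    | cons h _ ih => exact (hadj _ _ h).trans ih
  have hsurj : ∀ τ : W.TreeIdx, ∃ v, own v = τ := by
    intro τ
    let v : W.Vertex := ⟨(τ.1, W.tree τ), W.tree τ, W.tree_mem τ, VTree.mem_subtrees_self _⟩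
    refine ⟨v, ?_⟩
    obtain ⟨j, hj⟩ := exists_mem_idxs (W.tree τ)
    exact tree_idx_unique hW (h1 v) (idxs_subset_of_mem_subtrees (h2 v) hj) hj
  have : Nonempty W.TreeIdx := hc.nonempty.map own
  refine SimpleGraph.Connected.mk fun τ τ' => ?_
  obtain ⟨u, rfl⟩ := hsurj τ
  obtain ⟨v, rfl⟩ := hsurj τ'
  exact hreach u v

/-- Every tree other than `τ₀` is assigned the first bridge of a shortest path to `τ₀`. -/
lemma exists_bridge_assignment (hS : W.rset.IsRSet) (hW : W ∈ comb γ W.rset)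
    (hc : W.graph.Connected) (τ₀ : W.TreeIdx) :
    ∃ f : {τ // τ ≠ τ₀} → W.Bridge, Function.Injective f ∧ ∀ τ, (W.tree τ.1).m ∣ W.h (f τ) := by
  have hconn := treeGraph_connected hW hc
  have step : ∀ τ : {τ // τ ≠ τ₀}, ∃ (b : W.Bridge) (τ' : W.TreeIdx),
      ((W.LeftEnd b τ.1 ∧ W.RightEnd b τ') ∨ (W.LeftEnd b τ' ∧ W.RightEnd b τ.1)) ∧
      W.treeGraph.dist τ' τ₀ < W.treeGraph.dist τ.1 τ₀ := by
    rintro ⟨τ, hτ⟩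
    obtain ⟨p, hp⟩ := hconn.exists_walk_length_eq_dist τ τ₀
    cases p with
    | nil => exact absurd rfl hτ
    | cons h p =>
      rename_i τ'
      have hd := SimpleGraph.dist_le p
      rw [SimpleGraph.Walk.length_cons] at hp
      change _ = W.treeGraph.dist τ τ₀ at hp
      rw [treeGraph, SimpleGraph.fromRel_adj] at h
      rcases h.2 with ⟨b, hb⟩ | ⟨b, hb⟩
      · exact ⟨b, τ', Or.inl hb, by change _ < W.treeGraph.dist τ τ₀; omega⟩
      · exact ⟨b, τ', Or.inr hb, by change _ < W.treeGraph.dist τ τ₀; omega⟩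
  choose f par hf hd using step
  refine ⟨f, ?_, fun τ => ?_⟩
  · intro τ τ' he
    have hl : ∀ {b : W.Bridge} {σ σ' : W.TreeIdx}, W.LeftEnd b σ → W.LeftEnd b σ' → σ = σ' :=
      fun h h' => tree_idx_unique hW (h.1.trans h'.1.symm) h.2 h'.2
    have hr : ∀ {b : W.Bridge} {σ σ' : W.TreeIdx}, W.RightEnd b σ → W.RightEnd b σ' → σ = σ' :=
      fun h h' => tree_idx_unique hW (h.1.trans h'.1.symm) h.2 h'.2
    have h1 := hf τ
    have h2 := hf τ'
    have d1 := hd τ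
    have d2 := hd τ'
    rw [he] at h1
    rcases h1 with h1 | h1 <;> rcases h2 with h2 | h2
    · exact Subtype.ext (hl h1.1 h2.1)
    · rw [hl h2.1 h1.1] at d2
      rw [hr h1.2 h2.2] at d1
      omega
    · rw [hl h1.1 h2.1] at d1
      rw [hr h2.2 h1.2] at d2
      omega
    · exact Subtype.ext (hr h1.2 h2.2)
  · rcases hf τ with h | h
    · exact h.1.m_dvd_h hS hW
    · exact h.2.m_dvd_h hS hW

instance : Finite W.Vertex := by
  have : ({v : Fin r × VTree | ∃ T ∈ W.forest v.1, v.2 ∈ T.subtrees}).Finite := by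
    have h : {v : Fin r × VTree | ∃ T ∈ W.forest v.1, v.2 ∈ T.subtrees} ⊆
        ⋃ i : Fin r, (fun u => (i, u)) '' {u | u ∈ (W.forest i).flatMap VTree.subtrees} := by
      rintro ⟨i, u⟩ ⟨T, hT, hu⟩
      exact Set.mem_iUnion.2 ⟨i, u, List.mem_flatMap.2 ⟨T, hT, hu⟩, rfl⟩
    refine Set.Finite.subset (Set.finite_iUnion fun i => Set.Finite.image _ ?_) h
    exact List.finite_toSet _
  exact this.to_subtype

/-- In a connected combined forest of cycle rank `0` there is one more tree than there are bridges:
assigning to every vertex that is not a root the edge to its lower neighbour, and to every bridge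
itself, produces different edges. -/
lemma card_bridge_add_one (hr : 2 ≤ r) (hS : W.rset.IsRSet) (hW : W ∈ comb γ W.rset)
    (hc : W.graph.Connected) (hβ : W.cycleRank = 0) :
    Fintype.card W.TreeIdx = Fintype.card W.Bridge + 1 := by
  have : Nontrivial (Fin r) := Fin.nontrivial_iff_two_le.2 hr
  have hsub : ∀ i : Fin r, i - 1 ≠ i := fun i => by simp; omega
  let IsRoot : W.Vertex → Prop := fun v => v.1.2 ∈ W.forest v.1.1
  -- the lower neighbours
  have hpar : ∀ v : {v : W.Vertex // ¬ IsRoot v}, ∃ u : W.Vertex,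
      v.1.1.1 = u.1.1 ∧ v.1.1.2.IsUpper u.1.2 := by
    rintro ⟨⟨⟨i, v⟩, T, hT, hv⟩, hroot⟩
    obtain ⟨u, hu, huv⟩ := VTree.exists_isUpper hv (fun e => hroot (by subst e; exact hT))
    exact ⟨⟨(i, u), T, hT, hu⟩, rfl, huv⟩
  choose par hpar1 hpar2 using hpar
  -- the ends of the bridges
  have hleft : ∀ b : W.Bridge, ∃ u : W.Vertex, ∃ c n,
      u.1 = (b.1, VTree.leaf (W.leftIdx b) c n) := by
    intro b
    obtain ⟨τ, h1, h2⟩ := exists_mem_leaves hW (rowLabels_leftIdx hS b)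
    exact ⟨⟨(b.1, _), W.tree τ, h1 ▸ W.tree_mem τ, VTree.leaf_mem_subtrees h2⟩, _, _, rfl⟩
  have hright : ∀ b : W.Bridge, ∃ u : W.Vertex, ∃ c n,
      u.1 = (b.1 - 1, VTree.leaf (W.rightIdx b) c n) := by
    intro b
    obtain ⟨n, hn⟩ := rowLabels_rightIdx (γ := γ) hS b
    obtain ⟨τ, h1, h2⟩ := exists_mem_leaves hW hn
    exact ⟨⟨(b.1 - 1, _), W.tree τ, h1 ▸ W.tree_mem τ, VTree.leaf_mem_subtrees h2⟩, _, _, rfl⟩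
  choose ul hul using hleft
  choose ur hur using hright
  have hul1 : ∀ b, (ul b).1.1 = b.1 := fun b => by obtain ⟨c, n, e⟩ := hul b; rw [e]
  have hur1 : ∀ b, (ur b).1.1 = b.1 - 1 := fun b => by obtain ⟨c, n, e⟩ := hur b; rw [e]
  have hroots : Nat.card {v : W.Vertex // IsRoot v} ≤ Fintype.card W.TreeIdx := by
    rw [← Nat.card_eq_fintype_card]
    refine Nat.card_le_card_of_surjective
      (fun τ : W.TreeIdx => (⟨⟨(τ.1, W.tree τ), W.tree τ, W.tree_mem τ,
        VTree.mem_subtrees_self _⟩, W.tree_mem τ⟩ : {v : W.Vertex // IsRoot v})) ?_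
    rintro ⟨⟨⟨i, v⟩, hv⟩, hroot⟩
    obtain ⟨τ, rfl, rfl⟩ := exists_tree hroot
    exact ⟨τ, rfl⟩
  have hadj1 : ∀ v, W.graph.Adj v.1 (par v) := by
    intro v
    rw [graph, SimpleGraph.fromRel_adj]
    refine ⟨?_, Or.inl (Or.inl ⟨hpar1 v, hpar2 v⟩)⟩
    intro e
    have := (hpar2 v).length_zetas_lt
    rw [← e] at this
    exact this.false
  have hadj2 : ∀ b, W.graph.Adj (ul b) (ur b) := by
    intro b
    rw [graph, SimpleGraph.fromRel_adj]
    refine ⟨?_, Or.inl (Or.inr ⟨b, hul b, hur b⟩)⟩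
    intro e
    apply hsub b.1
    rw [← hur1 b, ← e, hul1 b]
  let φ : {v : W.Vertex // ¬ IsRoot v} ⊕ W.Bridge → W.graph.edgeSet :=
    Sum.elim (fun v => ⟨s(v.1, par v), hadj1 v⟩) fun b => ⟨s(ul b, ur b), hadj2 b⟩
  have hmix : ∀ v b, s(v.1, par v) ≠ s(ul b, ur b) := by
    intro v b e
    apply hsub b.1
    have := hpar1 v
    rcases Sym2.eq_iff.1 e with ⟨e1, e2⟩ | ⟨e1, e2⟩
    · rw [e1, e2, hul1, hur1] at this; exact this.symm
    · rw [e1, e2, hul1, hur1] at this; exact this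
  have hφ : Function.Injective φ := by
    rintro (v | b) (v' | b') e
    · have e' : s(v.1, par v) = s(v'.1, par v') := congrArg Subtype.val e
      rcases Sym2.eq_iff.1 e' with ⟨e1, -⟩ | ⟨e1, e2⟩
      · rw [Subtype.ext e1]
      · have h1 := (hpar2 v).length_zetas_lt
        have h2 := (hpar2 v').length_zetas_lt
        rw [e2, e1] at h1
        omega
    · exact absurd (congrArg Subtype.val e) (hmix v b')
    · exact absurd (congrArg Subtype.val e).symm (hmix v' b)
    · have e' : s(ul b, ur b) = s(ul b', ur b') := congrArg Subtype.val e
      rcases Sym2.eq_iff.1 e' with ⟨e1, -⟩ | ⟨e1, -⟩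
      · obtain ⟨c, n, h1⟩ := hul b
        obtain ⟨c', n', h2⟩ := hul b'
        rw [e1, h2] at h1
        simp only [Prod.mk.injEq, VTree.leaf.injEq] at h1
        rw [leftIdx_injective hS h1.1.symm h1.2.1.symm]
      · obtain ⟨c, n, h1⟩ := hul b
        obtain ⟨c', n', h2⟩ := hur b'
        rw [e1, h2] at h1
        simp only [Prod.mk.injEq, VTree.leaf.injEq] at h1
        -- left leaves precede right leaves
        have h3 := leftIdx_lt b
        rw [← h1.2.1, ← h1.1, rightIdx] at h3
        omega
  have hcard := Nat.card_le_card_of_injective φ hφ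
  rw [Nat.card_sum, Nat.card_eq_fintype_card (α := W.Bridge)] at hcard
  have hsplit : Nat.card W.Vertex =
      Nat.card {v : W.Vertex // IsRoot v} + Nat.card {v : W.Vertex // ¬ IsRoot v} := by
    rw [← Nat.card_sum]
    classical
    exact (Nat.card_congr (Equiv.sumCompl IsRoot)).symm
  have hle : Fintype.card W.TreeIdx ≤ Fintype.card W.Bridge + 1 := by
    obtain ⟨τ₀⟩ := (treeGraph_connected hW hc).nonempty
    obtain ⟨f, hf, -⟩ := exists_bridge_assignment hS hW hc τ₀
    classical
    have h1 := Fintype.card_le_of_injective f hf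
    rw [Fintype.card_subtype_compl, Fintype.card_subtype_eq] at h1
    omega
  unfold cycleRank at hβ
  omega

lemma expo_eq (hr : 2 ≤ r) (hS : W.rset.IsRSet) (hW : W ∈ comb γ W.rset)
    (hc : W.graph.Connected) (hβ : W.cycleRank = 0) :
    W.expo = ((∑ τ, (W.tree τ).zetas.length : ℕ) : ℤ) := by
  have h1 := card_bridge_add_one hr hS hW hc hβ
  have h2 := sum_length_leaves hW
  simp only [VTree.length_leaves, Finset.sum_add_distrib, Finset.sum_const, Finset.card_univ,
    smul_eq_mul, mul_one] at h2
  have h3 : Fintype.card W.Bridge = W.rset.lenLam := by simp [Triple.lenLam]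
  rw [expo]
  omega

lemma dvd_gcd_of_dvd_m (hgcd : W.rset.gcd = 1) (hW : W ∈ comb γ W.rset) {d : ℕ}
    (hd : ∀ τ, d ∣ (W.tree τ).m) : d ∣ 1 := by
  have hrow : ∀ i, ∀ p ∈ W.rowLabels γ i, (d : ℤ) ∣ p.1 := by
    intro i p hp
    obtain ⟨j, hj⟩ := List.getElem?_of_mem hp
    obtain ⟨τ, -, h⟩ := exists_mem_leaves hW hj
    exact (Int.natCast_dvd_natCast.2 (hd τ)).trans (VTree.m_dvd_leaf _ h)
  have hl : ∀ i, ∀ a ∈ ptnUnion (W.rset.mu i) (W.rset.lam i), d ∣ a := by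
    intro i a ha
    exact Int.natCast_dvd_natCast.1 (hrow i ((a : ℤ), 0) (by simp [rowLabels, ha]))
  have hrt : ∀ i, ∀ a ∈ ptnUnion (W.rset.nu i) (W.rset.lam (i + 1)), d ∣ a := by
    intro i a ha
    have := hrow i (-(a : ℤ), (γ i + 2) * a)
      (List.mem_append_right _ (List.mem_map_of_mem ha))
    exact Int.natCast_dvd_natCast.1 ((dvd_neg).1 this)
  rw [← hgcd, Triple.gcd]
  refine Finset.dvd_gcd fun i _ => ?_
  have : ∀ L : List ℕ, (∀ a ∈ L, d ∣ a) → d ∣ L.foldr Nat.gcd 0 := by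
    intro L hL
    induction L with
    | nil => simp
    | cons a L ih => exact Nat.dvd_gcd (hL a (by simp)) (ih fun b hb => hL b (by simp [hb]))
  refine this _ fun a ha => ?_
  rw [List.mem_append, List.mem_append] at ha
  rcases ha with (ha | ha) | ha
  · exact hl i a ((ptnUnion_perm _ _).mem_iff.2 (List.mem_append_left _ ha))
  · exact hrt i a ((ptnUnion_perm _ _).mem_iff.2 (List.mem_append_left _ ha))
  · exact hl i a ((ptnUnion_perm _ _).mem_iff.2 (List.mem_append_right _ ha))

end CombForest

/-! ### Criteria for the relations modulo `ℤ[t]` and `ℚ[t]` -/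

lemma subst_add {k : ℕ} (hk : 0 < k) (u v : K) : subst k (u + v) = subst k u + subst k v := by
  simp only [subst_eq_powHom k hk, map_add]

lemma subst_mul {k : ℕ} (hk : 0 < k) (u v : K) : subst k (u * v) = subst k u * subst k v := by
  simp only [subst_eq_powHom k hk, map_mul]

lemma subst_subst {k l : ℕ} (hk : 0 < k) (hl : 0 < l) (u : K) :
    subst l (subst k u) = subst (k * l) u := by
  rw [subst_eq_powHom k hk, subst_eq_powHom l hl, powHom_comp, subst_eq_powHom]

lemma MemL.add_mem_intT {u v : K} (hu : MemL u) (hv : v ∈ intT) : MemL (u + v) := by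
  obtain ⟨f₁, f₂, h, rfl⟩ := hu
  obtain ⟨P, rfl⟩ := mem_intT.1 hv
  by_cases hne : aeval t f₁ = (0 : K)
  · exact ⟨1, P, monic_one, by rw [hne, div_zero, zero_add, map_one, div_one]⟩
  · refine ⟨f₁, f₂ + P * f₁, h, ?_⟩
    rw [map_add, map_mul]
    field_simp

lemma memL_div_tk {k : ℕ} (hk : 0 < k) {u : K} (hu : u ∈ intT) : MemL (u / tk k) := by
  obtain ⟨P, rfl⟩ := mem_intT.1 hu
  obtain ⟨A, hA, e⟩ := exists_monic_tk hk
  exact ⟨A, P, hA, by rw [e]⟩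

lemma simZ_of_eq_add {u v w : K} (hv : MemL v) (hw : w ∈ intT) (h : u = v + w) : SimZ u v := by
  obtain ⟨P, hP⟩ := mem_intT.1 hw
  exact ⟨h ▸ hv.add_mem_intT hw, hv, P, by rw [h, ← hP]; ring⟩

/-- The ring `ℚ[t]`. -/
def ratT : Subring K := (eval₂RingHom (Rat.castHom K) t).range

lemma aeval_t_eq_rat (P : ℚ[X]) : aeval t P = eval₂RingHom (Rat.castHom K) t P := by
  rw [aeval_def, Subsingleton.elim (algebraMap ℚ K) (Rat.castHom K)]; rfl

lemma mem_ratT {u : K} : u ∈ ratT ↔ ∃ P : ℚ[X], u = aeval t P := by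
  simp only [ratT, RingHom.mem_range, aeval_t_eq_rat, eq_comm]

lemma ratCast_mem_ratT (a : ℚ) : (a : K) ∈ ratT :=
  mem_ratT.2 ⟨C a, by rw [aeval_t_eq_rat]; simp⟩

lemma t_mem_ratT : t ∈ ratT := mem_ratT.2 ⟨X, by simp⟩

lemma intT_le_ratT : intT ≤ ratT := by
  intro u hu
  obtain ⟨P, rfl⟩ := mem_intT.1 hu
  refine mem_ratT.2 ⟨P.map (Int.castRingHom ℚ), ?_⟩
  rw [aeval_t_eq, aeval_t_eq_rat, coe_eval₂RingHom, coe_eval₂RingHom, eval₂_map,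
    Subsingleton.elim ((Rat.castHom K).comp _) (Int.castRingHom K)]

lemma memQt_of_mem_ratT {u : K} (hu : u ∈ ratT) : MemQt u := by
  obtain ⟨P, rfl⟩ := mem_ratT.1 hu
  exact ⟨1, P, one_ne_zero, by rw [map_one, div_one]⟩

lemma simQ_zero {u : K} (hu : u ∈ ratT) : SimQ u 0 := by
  refine ⟨memQt_of_mem_ratT hu, memQt_of_mem_ratT (zero_mem _), ?_⟩
  obtain ⟨P, hP⟩ := mem_ratT.1 hu
  exact ⟨P, by rw [sub_zero, hP]⟩

lemma exists_simQ_div_t {u p v : K} (hp : p ∈ ratT) (hv : v ∈ ratT) (h : u = p / t + v) :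
    ∃ a : ℚ, SimQ u (algebraMap ℚ K a / t) := by
  have ht := t_ne
  obtain ⟨P, rfl⟩ := mem_ratT.1 hp
  obtain ⟨Q, rfl⟩ := mem_ratT.1 hv
  have hX : aeval t (X : ℚ[X]) = t := aeval_X t
  have e1 : aeval t P = aeval t P.divX * t + aeval t (C (P.coeff 0)) := by
    conv_lhs => rw [← divX_mul_X_add P]
    rw [map_add, map_mul, hX]
  have e2 : aeval t (C (P.coeff 0)) = algebraMap ℚ K (P.coeff 0) := by
    rw [aeval_t_eq_rat, coe_eval₂RingHom, eval₂_C,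
      Subsingleton.elim (algebraMap ℚ K) (Rat.castHom K)]
  refine ⟨P.coeff 0, ⟨X, P + Q * X, X_ne_zero, ?_⟩, ⟨X, C (P.coeff 0), X_ne_zero, ?_⟩,
    P.divX + Q, ?_⟩
  · rw [h, map_add, map_mul, hX]
    field_simp
  · rw [hX, e2]
  · rw [h, e1, e2, map_add]
    field_simp
    ring

/-- For odd `m` the Laurent polynomial `q^{m/2} + q^{-m/2}` is divisible by `q^{1/2} + q^{-1/2}`,
and `(q^{1/2} + q^{-1/2})² = t + 4`. -/
lemma exists_tk_add_four {m : ℕ} (hm : Odd m) : ∃ y ∈ intT, tk m + 4 = (t + 4) * y := by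
  have hx : x * x⁻¹ = 1 := mul_inv_cancel₀ x_ne
  have key : ∀ b : ℕ, ∃ w ∈ intT, x ^ (2 * b + 1 : ℤ) + x ^ (-(2 * b + 1 : ℤ)) =
      (x + x⁻¹) * w := by
    intro b
    have h2x : x ^ (2 : ℤ) + x ^ (-2 : ℤ) = t + 2 := by
      rw [t_eq, zpow_neg, ← inv_zpow]
      norm_cast
      linear_combination 2 * hx
    induction b using Nat.twoStepInduction with
    | zero => exact ⟨1, one_mem _, by simp⟩
    | one =>
      refine ⟨t + 1, add_mem t_mem_intT (one_mem _), ?_⟩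
      rw [t_eq, zpow_neg, ← inv_zpow]
      norm_num
      norm_cast
      linear_combination (x + x⁻¹) * hx
    | more b ih ih' =>
      obtain ⟨w, hw, e⟩ := ih
      obtain ⟨w', hw', e'⟩ := ih'
      refine ⟨(t + 2) * w' - w, sub_mem (mul_mem (add_mem t_mem_intT (natCast_mem _ 2)) hw') hw, ?_⟩
      have e3 : x ^ (2 * (b + 2 : ℕ) + 1 : ℤ) + x ^ (-(2 * (b + 2 : ℕ) + 1 : ℤ)) =
          (x ^ (2 : ℤ) + x ^ (-2 : ℤ)) *
            (x ^ (2 * (b + 1 : ℕ) + 1 : ℤ) + x ^ (-(2 * (b + 1 : ℕ) + 1 : ℤ))) -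
            (x ^ (2 * b + 1 : ℤ) + x ^ (-(2 * b + 1 : ℤ))) := by
        rw [add_mul (x ^ (2 : ℤ)), mul_add (x ^ (2 : ℤ)), mul_add (x ^ (-2 : ℤ))]
        simp only [← zpow_add₀ x_ne]
        push_cast
        rw [show 2 + (2 * ((b : ℤ) + 1) + 1) = 2 * (b + 2) + 1 by ring,
          show 2 + -(2 * ((b : ℤ) + 1) + 1) = -(2 * b + 1) by ring,
          show -2 + (2 * ((b : ℤ) + 1) + 1) = 2 * b + 1 by ring,
          show -2 + -(2 * ((b : ℤ) + 1) + 1) = -(2 * (b + 2) + 1) by ring]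
        ring
      rw [e3, e, e', h2x]
      ring
  obtain ⟨b, rfl⟩ := hm
  obtain ⟨w, hw, e⟩ := key b
  refine ⟨w ^ 2, pow_mem hw 2, ?_⟩
  have h1 : x ^ (2 * b + 1 : ℤ) * x ^ (-(2 * b + 1 : ℤ)) = 1 := by
    rw [← zpow_add₀ x_ne]; simp
  have h2 : tk (2 * b + 1) + 4 = (x ^ (2 * b + 1 : ℤ) + x ^ (-(2 * b + 1 : ℤ))) ^ 2 := by
    rw [tk, qnum]
    push_cast
    linear_combination (-4) * h1
  rw [h2, e, t_eq]
  linear_combination 4 * w ^ 2 * hx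

/-! ### The poles of the combined amplitude -/

namespace CombForest

variable {r : ℕ}

/-- The combined amplitude without its sign. -/
def core (W : CombForest r) : K :=
  (∏ τ, (W.tree τ).ampB) * ∏ b : W.Bridge, qnum (W.h b : ℤ) ^ 2

lemma ampH_eq (γ : Fin r → ℤ) (W : CombForest r) :
    W.ampH γ = (-1 : K) ^ (W.L1 + W.L2 γ) * W.core := by
  rw [ampH, core, prod_forest_eq_prod_tree, mul_assoc]

lemma prod_bridge (W : CombForest r) (f : ℕ → K) :
    ∏ b : W.Bridge, f (W.h b) = ∏ i, ((W.rset.lam i).map f).prod := by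
  rw [Fintype.prod_sigma]
  refine Finset.prod_congr rfl fun i _ => ?_
  rw [← Fin.prod_univ_fun_getElem]
  rfl

/-- The product over all vertices of all trees of `[k ζ_v] / [ζ_v]`. -/
def totalQfac (W : CombForest r) (k : ℕ) : K := ∏ τ, (W.tree τ).qfacProd k

/-- The product of the correction factors of all trees. -/
def totalType (W : CombForest r) (k : ℕ) : K := ∏ τ, (W.tree τ).typeFactor k

/-- The exponent `l(μ) + l(ν) + l(λ) - 1`, as the number of vertices that are not leaves. -/
def innerCard (W : CombForest r) : ℕ := ∑ τ, (W.tree τ).zetas.length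

lemma L1_scale (k : ℕ) (W : CombForest r) : (W.scale k).L1 = W.L1 := by
  simp [L1, scale, Triple.scale, Triple.lenMu, Triple.lenNu]

lemma L2_scale (γ : Fin r → ℤ) (k : ℕ) (W : CombForest r) :
    (W.scale k).L2 γ = k * W.L2 γ := by
  have h : ∀ L : List ℕ, (L.map (k * ·)).sum = k * L.sum := fun L => by
    simpa using L.sum_map_mul_left (f := id) k
  simp only [L2, scale, Triple.scale, Triple.degree, Finset.mul_sum, h, Nat.cast_add, Nat.cast_mul]
  exact Finset.sum_congr rfl fun i _ => by ring

lemma invHom_totalType (W : CombForest r) (k : ℕ) : invHom (W.totalType k) = W.totalType k := by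
  simp only [totalType, map_prod, VTree.invHom_typeFactor]

lemma totalType_of_odd (W : CombForest r) {k : ℕ} (hk : Odd k) : W.totalType k = 1 :=
  Finset.prod_eq_one fun _ _ => VTree.typeFactor_of_odd hk _

lemma totalType_of_even (W : CombForest r) {k : ℕ} (hk : Even k) :
    W.totalType k = W.totalType 2 :=
  Finset.prod_congr rfl fun _ _ => VTree.typeFactor_of_even hk _

lemma subst_ampH (γ : Fin r → ℤ) (W : CombForest r) {k : ℕ} (hk : 0 < k) :
    subst k (W.ampH γ) = (-1 : K) ^ (W.L1 + W.L2 γ) * subst k W.core := by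
  rw [ampH_eq, subst_mul hk]
  congr 1
  rw [subst_eq_powHom k hk, map_zpow₀, map_neg, map_one]

lemma subst_totalType {k : ℕ} (hk : 0 < k) (hke : Even k) (W : CombForest r) :
    subst k (W.totalType k) =
      ∏ i, ((W.typeI i).map fun T => 1 + tk (T.m * k / 2) / 2).prod := by
  rw [subst_eq_powHom k hk, totalType, map_prod,
    ← prod_forest_eq_prod_tree W fun T => powHom k hk (T.typeFactor k)]
  refine Finset.prod_congr rfl fun i _ => ?_
  rw [typeI]
  induction W.forest i with
  | nil => simp
  | cons T L ih =>
    rw [List.map_cons, List.prod_cons, ih, VTree.powHom_typeFactor hk hke hke, List.filter_cons]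
    by_cases h : Odd T.m ∧ Odd T.n <;> simp [h]

variable [NeZero r] {γ : Fin r → ℤ} {W : CombForest r}

lemma core_scale (hS : W.rset.IsRSet) (hW : W ∈ comb γ W.rset) {k : ℕ} (hk : 0 < k) :
    (W.scale k).core = subst k (W.core * W.totalQfac k) := by
  have h1 : ∏ τ, ((W.scale k).tree τ).ampB =
      powHom k hk (∏ τ, ((W.tree τ).ampB * (W.tree τ).qfacProd k)) := by
    rw [← prod_forest_eq_prod_tree (W.scale k) VTree.ampB, map_prod,
      ← prod_forest_eq_prod_tree W fun T => powHom k hk (T.ampB * T.qfacProd k)]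
    refine Finset.prod_congr rfl fun i _ => ?_
    simp only [scale, List.map_map]
    congr 1
    refine List.map_congr_left fun T hT => ?_
    obtain ⟨τ, -, rfl⟩ := exists_tree hT
    exact VTree.ampB_scale hk _ (tree_goodLabels hS hW τ) (tree_c hW τ)
  have h2 : ∏ b : (W.scale k).Bridge, qnum ((W.scale k).h b : ℤ) ^ 2 =
      powHom k hk (∏ b : W.Bridge, qnum (W.h b : ℤ) ^ 2) := by
    rw [prod_bridge (W.scale k) fun a => qnum (a : ℤ) ^ 2, map_prod,
      prod_bridge W fun a => powHom k hk (qnum (a : ℤ) ^ 2)]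
    refine Finset.prod_congr rfl fun i _ => ?_
    simp only [scale, Triple.scale, List.map_map]
    congr 1
    refine List.map_congr_left fun a _ => ?_
    simp [powHom_qnum]
  rw [core, h1, h2, subst_eq_powHom k hk, ← map_mul, core, totalQfac, Finset.prod_mul_distrib]
  congr 1
  ring

/-- For every tree `τ₀`, the amplitude has at most the pole `1 / t_{m(τ₀)}`: the poles of the other
trees are cancelled by the bridges assigned to them. -/
lemma qnum_m_sq_mul_core_mem (hS : W.rset.IsRSet) (hW : W ∈ comb γ W.rset)
    (hc : W.graph.Connected) (τ₀ : W.TreeIdx) :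
    qnum (W.tree τ₀).m ^ 2 * W.core ∈ laurentRing := by
  classical
  obtain ⟨f, hf, hdvd⟩ := exists_bridge_assignment hS hW hc τ₀
  have hB : ∀ τ, qnum (W.tree τ).m ^ 2 * (W.tree τ).ampB ∈ laurentRing := fun τ =>
    VTree.qnum_m_sq_mul_ampB_mem _ (tree_goodLabels hS hW τ) (tree_c hW τ)
  have h1 : ∏ b : W.Bridge, qnum (W.h b : ℤ) ^ 2 =
      (∏ τ, qnum (W.h (f τ) : ℤ) ^ 2) *
        ∏ b ∈ (Finset.univ.image f)ᶜ, qnum (W.h b : ℤ) ^ 2 := by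
    rw [← Finset.prod_mul_prod_compl (Finset.univ.image f), Finset.prod_image hf.injOn]
  have h2 : qnum (W.tree τ₀).m ^ 2 * W.core = (qnum (W.tree τ₀).m ^ 2 * (W.tree τ₀).ampB) *
      (∏ τ : {τ // τ ≠ τ₀}, ((W.tree τ.1).ampB * qnum (W.h (f τ) : ℤ) ^ 2)) *
        ∏ b ∈ (Finset.univ.image f)ᶜ, qnum (W.h b : ℤ) ^ 2 := by
    rw [core, h1, Fintype.prod_eq_mul_prod_subtype_ne _ τ₀, Finset.prod_mul_distrib]
    ring
  rw [h2]
  refine mul_mem (mul_mem (hB τ₀) (prod_mem fun τ _ => ?_))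
    (prod_mem fun b _ => pow_mem (qnum_mem _) 2)
  have hd : ((W.tree τ.1).m : ℤ) ∣ (W.h (f τ) : ℤ) := Int.natCast_dvd_natCast.2 (hdvd τ)
  have h3 : qnum (W.h (f τ)) * (qnum (W.tree τ.1).m * (W.tree τ.1).ampB) ∈ laurentRing :=
    qnum_mul_mem_of_dvd hd (by convert hB τ.1 using 1; ring)
  have h4 : qnum (W.h (f τ)) * (qnum (W.h (f τ)) * (W.tree τ.1).ampB) ∈ laurentRing :=
    qnum_mul_mem_of_dvd hd (by convert h3 using 1; ring)
  convert h4 using 1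
  ring

lemma invHom_core (hS : W.rset.IsRSet) (hW : W ∈ comb γ W.rset) : invHom W.core = W.core := by
  simp only [core, map_mul, map_prod, map_pow, invHom_qnum, neg_sq]
  congr 1
  exact Finset.prod_congr rfl fun τ _ =>
    VTree.invHom_ampB _ (tree_goodLabels hS hW τ) (tree_c hW τ)

lemma negHom_core (hS : W.rset.IsRSet) (hW : W ∈ comb γ W.rset) : negHom W.core = W.core := by
  simp only [core, map_mul, map_prod, map_pow, negHom_qnum]
  congr 1
  · exact Finset.prod_congr rfl fun τ _ =>
      VTree.negHom_ampB _ (tree_goodLabels hS hW τ) (tree_c hW τ)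
  · refine Finset.prod_congr rfl fun b _ => ?_
    rw [mul_pow, ← zpow_natCast, ← zpow_mul, mul_comm _ ((2 : ℕ) : ℤ), Nat.cast_ofNat,
      (even_two_mul _).neg_one_zpow, one_mul]

/-- The only pole of the amplitude is `1 / t`. -/
lemma t_mul_core_mem (hS : W.rset.IsRSet) (hgcd : W.rset.gcd = 1) (hW : W ∈ comb γ W.rset)
    (hc : W.graph.Connected) : t * W.core ∈ intT := by
  classical
  have key : ∀ s : Finset W.TreeIdx,
      qnum ((s.gcd fun τ => (W.tree τ).m : ℕ) : ℤ) ^ 2 * W.core ∈ laurentRing := by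
    intro s
    induction s using Finset.induction with
    | empty => simp [qnum_zero, zero_mem]
    | insert τ s _ ih =>
      have h := qnum_gcd_sq_mul_mem' (qnum_m_sq_mul_core_mem hS hW hc τ) ih
      rw [Finset.gcd_insert]
      exact h
  have h1 := key Finset.univ
  have h2 : (Finset.univ.gcd fun τ => (W.tree τ).m) = 1 :=
    Nat.dvd_one.1 (dvd_gcd_of_dvd_m hgcd hW fun τ => Finset.gcd_dvd (Finset.mem_univ τ))
  rw [h2] at h1
  refine mem_intT_of_fixed h1 ?_ ?_
  · rw [map_mul, invHom_t, invHom_core hS hW]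
  · rw [map_mul, negHom_t, negHom_core hS hW]

/-! ### Comparison of the amplitudes of `W_(k)` and `W` -/

lemma congT_totalQfac (hS : W.rset.IsRSet) (hW : W ∈ comb γ W.rset) (k : ℕ) :
    CongT (W.totalQfac k) ((k : K) ^ W.innerCard * W.totalType k) := by
  have h := CongT.finset_prod Finset.univ (f := fun τ => (W.tree τ).qfacProd k)
    (g := fun τ => (k : K) ^ (W.tree τ).zetas.length * (W.tree τ).typeFactor k)
    fun τ _ => VTree.congT_qfacProd _ (tree_goodLabels hS hW τ) (tree_c hW τ)
  rw [Finset.prod_mul_distrib, Finset.prod_pow_eq_pow_sum] at h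
  exact h

/-- The substitution `q → q^k` makes a Laurent polynomial in `q^{1/2}` that is symmetric under
`q → q^{-1}` a polynomial in `t`. For even `k` no condition on the parity of the exponents is needed,
because `q^{k/2}` is an integral power of `q`. -/
lemma subst_mem_intT {k : ℕ} (hk : 0 < k) {u : K} (hu : u ∈ laurentRing) (hi : invHom u = u)
    (hn : Odd k → negHom u = u) : subst k u ∈ intT := by
  rw [subst_eq_powHom k hk]
  refine mem_intT_of_fixed (powHom_mem hk hu) (by rw [invHom_powHom, hi]) ?_
  rcases Nat.even_or_odd k with h | h
  · exact negHom_powHom_of_even hk h u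
  · rw [negHom_powHom_of_odd hk h, hn h]

/-- The main comparison: the factor `∏ [k ζ_v] / [ζ_v]` may be replaced by its residue modulo `t`,
since `t` cancels the only pole of the amplitude of `W`. -/
lemma exists_core_scale_eq (hS : W.rset.IsRSet) (hgcd : W.rset.gcd = 1) (hW : W ∈ comb γ W.rset)
    (hc : W.graph.Connected) {k : ℕ} (hk : 0 < k) :
    ∃ u ∈ intT, (W.scale k).core =
      (k : K) ^ W.innerCard * subst k (W.core * W.totalType k) + u := by
  obtain ⟨-, d, hd, e⟩ := congT_totalQfac hS hW k
  have hdt : t * d = W.totalQfac k - (k : K) ^ W.innerCard * W.totalType k := by rw [e]; ring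
  have hdi : invHom d = d := by
    have h := congrArg invHom hdt
    rw [map_sub, map_mul, map_mul, map_pow, map_natCast, invHom_totalType, totalQfac, map_prod,
      invHom_t] at h
    simp only [VTree.invHom_qfacProd] at h
    exact mul_left_cancel₀ t_ne (h.trans hdt.symm)
  have hdn : Odd k → negHom d = d := by
    intro ho
    have h := congrArg negHom hdt
    rw [map_sub, map_mul, map_mul, map_pow, map_natCast, totalType_of_odd W ho, map_one, totalQfac,
      map_prod, negHom_t] at h
    simp only [VTree.negHom_qfacProd_of_odd ho] at h
    rw [totalType_of_odd W ho] at hdt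
    exact mul_left_cancel₀ t_ne (h.trans hdt.symm)
  have hP := t_mul_core_mem hS hgcd hW hc
  refine ⟨subst k (t * W.core) * subst k d, mul_mem ?_ (subst_mem_intT hk hd hdi hdn), ?_⟩
  · rw [subst_eq_powHom k hk]; exact powHom_mem_intT hk hP
  · rw [core_scale hS hW hk, e]
    have h1 : (k : K) ^ W.innerCard = subst k ((k : K) ^ W.innerCard) := by
      rw [subst_eq_powHom k hk, map_pow, map_natCast]
    rw [h1, ← subst_mul hk, ← subst_mul hk, ← subst_add hk]
    congr 1
    rw [← h1]
    ring

lemma memL_subst_core (hS : W.rset.IsRSet) (hgcd : W.rset.gcd = 1) (hW : W ∈ comb γ W.rset)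
    (hc : W.graph.Connected) {k : ℕ} (hk : 0 < k) {ε : K} (hε : ε ∈ intT) :
    MemL (ε * ((k : K) ^ W.innerCard * subst k (W.core * W.totalType k))) := by
  have hP := t_mul_core_mem hS hgcd hW hc
  have hmem := (congT_totalQfac hS hW k).1
  have h1 : subst k ((k : K) ^ W.innerCard * W.totalType k) ∈ intT := by
    refine subst_mem_intT hk hmem ?_ fun ho => ?_
    · rw [map_mul, map_pow, map_natCast, invHom_totalType]
    · rw [totalType_of_odd W ho, map_mul, map_pow, map_natCast, map_one]
  have h2 : subst k (t * W.core) ∈ intT := by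
    rw [subst_eq_powHom k hk]; exact powHom_mem_intT hk hP
  have h3 := memL_div_tk hk (mul_mem (mul_mem hε h1) h2)
  have htk : tk k ≠ 0 := pow_ne_zero _ (qnum_ne (by exact_mod_cast hk.ne'))
  convert h3 using 1
  simp only [subst_eq_powHom k hk, map_mul, map_pow, map_natCast, powHom_t]
  field_simp

lemma neg_one_zpow_mem_intT (a : ℤ) : (-1 : K) ^ a ∈ intT := by
  rcases Int.even_or_odd a with h | h
  · rw [h.neg_one_zpow]; exact one_mem _
  · rw [h.neg_one_zpow]; exact neg_mem (one_mem _)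

lemma neg_one_zpow_eq_of_even_sub {a b : ℤ} (h : Even (a - b)) : (-1 : K) ^ a = (-1) ^ b := by
  have : a = b + (a - b) := by ring
  rw [this, zpow_add₀ (by norm_num), h.neg_one_zpow, mul_one]

/-- Up to a polynomial in `t`, the amplitude of `W_(k)`. -/
lemma exists_ampH_scale_eq (hS : W.rset.IsRSet) (hgcd : W.rset.gcd = 1) (hW : W ∈ comb γ W.rset)
    (hc : W.graph.Connected) {k : ℕ} (hk : 0 < k) :
    ∃ u ∈ intT, (W.scale k).ampH γ = (-1 : K) ^ (W.L1 + k * W.L2 γ) *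
      ((k : K) ^ W.innerCard * subst k (W.core * W.totalType k)) + u := by
  obtain ⟨u, hu, e⟩ := exists_core_scale_eq hS hgcd hW hc hk
  refine ⟨(-1 : K) ^ (W.L1 + k * W.L2 γ) * u, mul_mem (neg_one_zpow_mem_intT _) hu, ?_⟩
  rw [ampH_eq, L1_scale, L2_scale, e]
  ring

lemma simZ_of_odd (hS : W.rset.IsRSet) (hgcd : W.rset.gcd = 1) (hW : W ∈ comb γ W.rset)
    (hc : W.graph.Connected) {k : ℕ} (hk : Odd k) :
    SimZ ((W.scale k).ampH γ) ((k : K) ^ W.innerCard * subst k (W.ampH γ)) := by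
  obtain ⟨u, hu, e⟩ := exists_ampH_scale_eq hS hgcd hW hc hk.pos
  have h1 : (-1 : K) ^ (W.L1 + k * W.L2 γ) = (-1) ^ (W.L1 + W.L2 γ) := by
    refine neg_one_zpow_eq_of_even_sub ?_
    obtain ⟨j, rfl⟩ := hk
    exact ⟨j * W.L2 γ, by push_cast; ring⟩
  have h2 : (k : K) ^ W.innerCard * subst k (W.ampH γ) = (-1 : K) ^ (W.L1 + k * W.L2 γ) *
      ((k : K) ^ W.innerCard * subst k (W.core * W.totalType k)) := by
    rw [subst_ampH γ W hk.pos, totalType_of_odd W hk, mul_one, h1]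
    ring
  refine simZ_of_eq_add ?_ hu (h2 ▸ e)
  rw [h2]
  exact memL_subst_core hS hgcd hW hc hk.pos (neg_one_zpow_mem_intT _)

lemma simZ_of_even (hS : W.rset.IsRSet) (hgcd : W.rset.gcd = 1) (hW : W ∈ comb γ W.rset)
    (hc : W.graph.Connected) {k : ℕ} (hk : 0 < k) (hke : Even k) :
    SimZ ((W.scale k).ampH γ) ((-1 : K) ^ W.L2 γ * (k : K) ^ W.innerCard * subst k (W.ampH γ)
      * ∏ i, ((W.typeI i).map fun T => 1 + tk (T.m * k / 2) / 2).prod) := by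
  obtain ⟨u, hu, e⟩ := exists_ampH_scale_eq hS hgcd hW hc hk
  have h1 : (-1 : K) ^ (W.L1 + k * W.L2 γ) = (-1) ^ W.L2 γ * (-1) ^ (W.L1 + W.L2 γ) := by
    rw [← zpow_add₀ (by norm_num)]
    refine neg_one_zpow_eq_of_even_sub ?_
    obtain ⟨j, rfl⟩ := hke
    exact ⟨j * W.L2 γ - W.L2 γ, by push_cast; ring⟩
  have h2 : (-1 : K) ^ W.L2 γ * (k : K) ^ W.innerCard * subst k (W.ampH γ)
      * ∏ i, ((W.typeI i).map fun T => 1 + tk (T.m * k / 2) / 2).prod =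
      (-1 : K) ^ (W.L1 + k * W.L2 γ) *
      ((k : K) ^ W.innerCard * subst k (W.core * W.totalType k)) := by
    rw [subst_ampH γ W hk, ← subst_totalType hk hke, subst_mul hk, h1]
    ring
  refine simZ_of_eq_add ?_ hu (h2 ▸ e)
  rw [h2]
  exact memL_subst_core hS hgcd hW hc hk (neg_one_zpow_mem_intT _)

/-! ### The combination `𝓖_k` -/

/-- The value at `q^{1/2} = i` of the product of the correction factors is a sign, determined by
the sum of the root labels. -/
lemma exists_subst_totalType_two (hS : W.rset.IsRSet) (hW : W ∈ comb γ W.rset) :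
    ∃ y ∈ ratT, subst 2 (W.totalType 2) = (-1 : K) ^ W.L2 γ + (t + 4) * y := by
  classical
  have h4 : t + 4 ∈ ratT := add_mem t_mem_ratT (natCast_mem _ 4)
  have hs : ∀ a : ℤ, (-1 : K) ^ a ∈ ratT := fun a => intT_le_ratT (neg_one_zpow_mem_intT a)
  have hτ : ∀ τ, ∃ y ∈ ratT, powHom 2 two_pos ((W.tree τ).typeFactor 2) =
      (-1 : K) ^ (W.tree τ).n + (t + 4) * y := by
    intro τ
    rw [VTree.powHom_typeFactor two_pos even_two even_two]
    by_cases hn : Odd (W.tree τ).n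
    · have hm : Odd (W.tree τ).m := by
        obtain ⟨v, hv⟩ := VTree.m_dvd_n _ (tree_goodLabels hS hW τ)
        rw [hv, Int.odd_mul] at hn
        exact_mod_cast hn.1
      obtain ⟨y, hy, e⟩ := exists_tk_add_four hm
      refine ⟨((1 / 2 : ℚ) : K) * y, mul_mem (ratCast_mem_ratT _) (intT_le_ratT hy), ?_⟩
      rw [if_pos ⟨hm, hn⟩, hn.neg_one_zpow, Nat.mul_div_cancel _ two_pos]
      push_cast
      linear_combination (1 / 2) * e
    · refine ⟨0, zero_mem _, ?_⟩
      rw [if_neg (by tauto), (Int.not_odd_iff_even.1 hn).neg_one_zpow]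
      ring
  have key : ∀ s : Finset W.TreeIdx, ∃ y ∈ ratT,
      ∏ τ ∈ s, powHom 2 two_pos ((W.tree τ).typeFactor 2) =
        (-1 : K) ^ (∑ τ ∈ s, (W.tree τ).n) + (t + 4) * y := by
    intro s
    induction s using Finset.induction with
    | empty => exact ⟨0, zero_mem _, by simp⟩
    | insert τ s hts ih =>
      obtain ⟨y, hy, e⟩ := hτ τ
      obtain ⟨z, hz, e'⟩ := ih
      refine ⟨y * (-1 : K) ^ (∑ τ ∈ s, (W.tree τ).n) + (-1 : K) ^ (W.tree τ).n * z +
        (t + 4) * (y * z), add_mem (add_mem (mul_mem hy (hs _)) (mul_mem (hs _) hz))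
          (mul_mem h4 (mul_mem hy hz)), ?_⟩
      rw [Finset.prod_insert hts, Finset.sum_insert hts, e, e', zpow_add₀ (by norm_num)]
      ring
  obtain ⟨y, hy, e⟩ := key Finset.univ
  refine ⟨y, hy, ?_⟩
  rw [subst_eq_powHom 2 two_pos, totalType, map_prod, e, sum_n hS hW]
  congr 1
  refine neg_one_zpow_eq_of_even_sub ⟨∑ i, (W.rset.degree i : ℤ), ?_⟩
  rw [L2, ← Finset.sum_sub_distrib, ← Finset.sum_add_distrib]
  exact Finset.sum_congr rfl fun i _ => by ring

lemma sum_moebius_div (k : ℕ) (hk : 1 < k) :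
    ∑ j ∈ k.divisors, ((ArithmeticFunction.moebius (k / j) : ℤ) : K) = 0 := by
  rw [Nat.sum_div_divisors k fun j => ((ArithmeticFunction.moebius j : ℤ) : K), ← Int.cast_sum,
    ← ArithmeticFunction.coe_mul_zeta_apply, ArithmeticFunction.moebius_mul_coe_zeta,
    ArithmeticFunction.one_apply_ne hk.ne', Int.cast_zero]

lemma sum_moebius_div_even (k : ℕ) (hk : 2 < k) :
    ∑ j ∈ k.divisors with Even j, ((ArithmeticFunction.moebius (k / j) : ℤ) : K) = 0 := by
  rcases Nat.even_or_odd' k with ⟨l, rfl | hl⟩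
  · have h1 : {j ∈ (2 * l).divisors | Even j} = l.divisors.image (2 * ·) := by
      ext j
      simp only [Finset.mem_filter, Nat.mem_divisors, Finset.mem_image]
      constructor
      · rintro ⟨⟨hd, -⟩, i, rfl⟩
        rw [← two_mul] at hd ⊢
        exact ⟨i, ⟨Nat.dvd_of_mul_dvd_mul_left two_pos hd, by omega⟩, rfl⟩
      · rintro ⟨i, ⟨hd, hl⟩, rfl⟩
        exact ⟨⟨Nat.mul_dvd_mul_left 2 hd, by omega⟩, even_two_mul i⟩
    rw [h1, Finset.sum_image (by intro a _ b _ h; simpa using h), ← sum_moebius_div l (by omega)]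
    exact Finset.sum_congr rfl fun j _ => by rw [Nat.mul_div_mul_left _ _ two_pos]
  · rw [Finset.sum_filter]
    refine Finset.sum_eq_zero fun j hj => if_neg fun he => ?_
    have := he.trans_dvd (Nat.dvd_of_mem_divisors hj)
    exact Nat.not_even_iff_odd.2 ⟨l, hl⟩ this

/-- Up to polynomials in `t`, the summand of `𝓖_k` for `k'` depends only on the parity of `k'`. -/
lemma exists_ampG_eq (hS : W.rset.IsRSet) (hgcd : W.rset.gcd = 1) (hW : W ∈ comb γ W.rset)
    (hc : W.graph.Connected) (he : W.expo = W.innerCard) {k : ℕ} (hk : 0 < k) :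
    ∃ u ∈ ratT, W.ampG γ k = (∑ j ∈ k.divisors, ((ArithmeticFunction.moebius (k / j) : ℤ) : K) *
      if Even j then (-1 : K) ^ W.L1 * subst k (W.core * W.totalType 2)
        else (-1 : K) ^ (W.L1 + W.L2 γ) * subst k W.core) + u := by
  have term : ∀ j : ℕ, ∃ u ∈ ratT, j ∈ k.divisors →
      ((ArithmeticFunction.moebius (k / j) : ℤ) : K) * (j : K) ^ (-W.expo)
        * subst (k / j) ((W.scale j).ampH γ) =
      ((ArithmeticFunction.moebius (k / j) : ℤ) : K) *
        (if Even j then (-1 : K) ^ W.L1 * subst k (W.core * W.totalType 2)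
          else (-1 : K) ^ (W.L1 + W.L2 γ) * subst k W.core) + u := by
    intro j
    by_cases hj : j ∈ k.divisors
    swap
    · exact ⟨0, zero_mem _, fun h => absurd h hj⟩
    have hj0 : 0 < j := Nat.pos_of_mem_divisors hj
    have hd := Nat.dvd_of_mem_divisors hj
    have hl : 0 < k / j := Nat.div_pos (Nat.le_of_dvd hk hd) hj0
    obtain ⟨u, hu, e⟩ := exists_ampH_scale_eq hS hgcd hW hc hj0
    have hjK : (j : K) ^ W.innerCard ≠ 0 := pow_ne_zero _ (Nat.cast_ne_zero.2 hj0.ne')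
    refine ⟨((ArithmeticFunction.moebius (k / j) : ℤ) : K) * ((j : K) ^ (-W.expo)
      * subst (k / j) u), mul_mem (intCast_mem _ _) (mul_mem ?_ ?_), fun _ => ?_⟩
    · have := ratCast_mem_ratT ((j : ℚ) ^ (-W.expo))
      push_cast at this
      exact this
    · rw [subst_eq_powHom _ hl]; exact intT_le_ratT (powHom_mem_intT hl hu)
    · have h1 : subst (k / j) ((-1 : K) ^ (W.L1 + j * W.L2 γ) *
          ((j : K) ^ W.innerCard * subst j (W.core * W.totalType j))) =
          (-1 : K) ^ (W.L1 + j * W.L2 γ) *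
          ((j : K) ^ W.innerCard * subst k (W.core * W.totalType j)) := by
        rw [subst_mul hl, subst_mul hl, subst_subst hj0 hl, Nat.mul_div_cancel' hd,
          subst_eq_powHom _ hl, subst_eq_powHom _ hl, map_zpow₀, map_neg, map_one, map_pow,
          map_natCast]
      have h2 : (if Even j then (-1 : K) ^ W.L1 * subst k (W.core * W.totalType 2)
          else (-1 : K) ^ (W.L1 + W.L2 γ) * subst k W.core) =
          (-1 : K) ^ (W.L1 + j * W.L2 γ) * subst k (W.core * W.totalType j) := by
        split_ifs with hev
        · rw [totalType_of_even W hev]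
          congr 1
          refine neg_one_zpow_eq_of_even_sub ?_
          obtain ⟨i, rfl⟩ := hev
          exact ⟨-(i * W.L2 γ), by push_cast; ring⟩
        · have ho := Nat.not_even_iff_odd.1 hev
          rw [totalType_of_odd W ho, mul_one]
          congr 1
          refine neg_one_zpow_eq_of_even_sub ?_
          obtain ⟨i, rfl⟩ := ho
          exact ⟨-(i * W.L2 γ), by push_cast; ring⟩
      rw [e, subst_add hl, h1, h2, he, zpow_neg, zpow_natCast]
      field_simp
  choose u hu hterm using term
  refine ⟨∑ j ∈ k.divisors, u j, sum_mem fun j _ => hu j, ?_⟩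
  rw [ampG, ← Finset.sum_add_distrib]
  exact Finset.sum_congr rfl fun j hj => hterm j hj

lemma ampG_mem_ratT (hS : W.rset.IsRSet) (hgcd : W.rset.gcd = 1) (hW : W ∈ comb γ W.rset)
    (hc : W.graph.Connected) (he : W.expo = W.innerCard) {k : ℕ} (hk : 2 < k) :
    W.ampG γ k ∈ ratT := by
  obtain ⟨u, hu, e⟩ := exists_ampG_eq hS hgcd hW hc he (by omega : 0 < k)
  have h0 : ∀ A B : K, ∑ j ∈ k.divisors, ((ArithmeticFunction.moebius (k / j) : ℤ) : K) *
      (if Even j then A else B) = 0 := by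
    intro A B
    have h1 : ∀ j : ℕ, ((ArithmeticFunction.moebius (k / j) : ℤ) : K) *
        (if Even j then A else B) = ((ArithmeticFunction.moebius (k / j) : ℤ) : K) * B +
          (if Even j then ((ArithmeticFunction.moebius (k / j) : ℤ) : K) else 0) * (A - B) := by
      intro j
      split_ifs <;> ring
    rw [Finset.sum_congr rfl fun j _ => h1 j, Finset.sum_add_distrib, ← Finset.sum_mul,
      ← Finset.sum_mul, sum_moebius_div k (by omega), ← Finset.sum_filter,
      sum_moebius_div_even k hk]
    ring
  rw [e, h0, zero_add]
  exact hu

lemma exists_simQ_ampG_one (hS : W.rset.IsRSet) (hgcd : W.rset.gcd = 1) (hW : W ∈ comb γ W.rset)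
    (hc : W.graph.Connected) (he : W.expo = W.innerCard) :
    ∃ a : ℚ, SimQ (W.ampG γ 1) (algebraMap ℚ K a / t) := by
  obtain ⟨u, hu, e⟩ := exists_ampG_eq hS hgcd hW hc he one_pos
  have hP := powHom_mem_intT one_pos (t_mul_core_mem hS hgcd hW hc)
  refine exists_simQ_div_t (p := (-1 : K) ^ (W.L1 + W.L2 γ) * powHom 1 one_pos (t * W.core))
    (mul_mem (intT_le_ratT (neg_one_zpow_mem_intT _)) (intT_le_ratT hP)) hu ?_
  have ht := t_ne
  rw [e, map_mul, powHom_t, show tk 1 = t from rfl]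
  simp only [Nat.divisors_one, Finset.sum_singleton, Nat.not_even_one, if_false,
    subst_eq_powHom 1 one_pos]
  simp only [Nat.div_self one_pos, ArithmeticFunction.moebius_apply_one, Int.cast_one]
  field_simp

/-- For `k = 2` the pole at `t = -4` of the substituted amplitude cancels, because the correction
factor takes the value `(-1)^{L_2}` there. -/
lemma exists_simQ_ampG_two (hS : W.rset.IsRSet) (hgcd : W.rset.gcd = 1) (hW : W ∈ comb γ W.rset)
    (hc : W.graph.Connected) (he : W.expo = W.innerCard) :
    ∃ a : ℚ, SimQ (W.ampG γ 2) (algebraMap ℚ K a / t) := by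
  obtain ⟨u, hu, e⟩ := exists_ampG_eq hS hgcd hW hc he two_pos
  obtain ⟨y, hy, ey⟩ := exists_subst_totalType_two hS hW
  have hP := powHom_mem_intT two_pos (t_mul_core_mem hS hgcd hW hc)
  refine exists_simQ_div_t (p := (-1 : K) ^ W.L1 * powHom 2 two_pos (t * W.core) * y)
    (mul_mem (mul_mem (intT_le_ratT (neg_one_zpow_mem_intT _)) (intT_le_ratT hP)) hy) hu ?_
  have ht := t_ne
  have ht2 : tk 2 ≠ 0 := pow_ne_zero _ (qnum_ne (by norm_num))
  have htt : tk 2 = t * (t + 4) := by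
    have hx : x * x⁻¹ = 1 := mul_inv_cancel₀ x_ne
    rw [t_eq, tk, qnum]
    have h1 : x ^ ((2 : ℕ) : ℤ) = x ^ 2 := zpow_natCast x 2
    have h2 : x ^ (-((2 : ℕ) : ℤ)) = x⁻¹ ^ 2 := by rw [zpow_neg, h1, inv_pow]
    rw [h1, h2]
    linear_combination 4 * (x - x⁻¹) ^ 2 * hx
  have h4 : t + 4 ≠ 0 := fun h => ht2 (by rw [htt, h, mul_zero])
  have hdiv : (2 : ℕ).divisors = {1, 2} := by decide
  rw [e, map_mul, powHom_t, hdiv, Finset.sum_pair (by norm_num), subst_mul two_pos, ey, htt,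
    subst_eq_powHom 2 two_pos, zpow_add₀ (by norm_num)]
  simp only [Nat.not_even_one, if_false, even_two, if_true, Nat.div_one, Nat.div_self two_pos,
    ArithmeticFunction.moebius_apply_one, ArithmeticFunction.moebius_apply_prime Nat.prime_two]
  push_cast
  field_simp
  ring

end CombForest

end TopString

end

theorem proposition5p4 (r : ℕ) [NeZero r] (hr : 2 ≤ r) (γ : Fin r → ℤ)
    (S : TopString.Triple r) (hS : S.IsRSet) (hgcd : S.gcd = 1)
    (W : TopString.CombForest r) (hW : W ∈ TopString.combConnected γ S)
    (hβ : W.cycleRank = 0) :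
    (∀ k : ℕ, Odd k →
      TopString.SimZ ((W.scale k).ampH γ)
        ((k : TopString.K) ^ W.expo * TopString.subst k (W.ampH γ))) ∧
    (∀ k : ℕ, 0 < k → Even k →
      TopString.SimZ ((W.scale k).ampH γ)
        ((-1 : TopString.K) ^ W.L2 γ * (k : TopString.K) ^ W.expo * TopString.subst k (W.ampH γ)
          * ∏ i, ((W.typeI i).map fun T => 1 + TopString.tk (T.m * k / 2) / 2).prod)) ∧
    (∀ k : ℕ, 2 < k → TopString.SimQ (W.ampG γ k) 0) ∧
    (∀ k : ℕ, k = 1 ∨ k = 2 →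
      ∃ a : ℚ, TopString.SimQ (W.ampG γ k) (algebraMap ℚ TopString.K a / TopString.t)) := by
  obtain ⟨hW, hc⟩ := hW
  obtain rfl := hW.1
  have he : W.expo = W.innerCard := TopString.CombForest.expo_eq hr hS hW hc hβ
  refine ⟨fun k hk => ?_, fun k hk hke => ?_, fun k hk => ?_, ?_⟩
  · rw [he, zpow_natCast]
    exact TopString.CombForest.simZ_of_odd hS hgcd hW hc hk
  · rw [he, zpow_natCast]
    exact TopString.CombForest.simZ_of_even hS hgcd hW hc hk hke
  · exact TopString.simQ_zero (TopString.CombForest.ampG_mem_ratT hS hgcd hW hc he hk)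
  · rintro k (rfl | rfl)
    · exact TopString.CombForest.exists_simQ_ampG_one hS hgcd hW hc he
    · exact TopString.CombForest.exists_simQ_ampG_two hS hgcd hW hc he
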